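/- Fix a field $\mathbb K$ and a grading group $G$ (an abelian group with a distinguished degree-one element and a parity homomorphism to $\mathbb Z/2$ sending that element to $1$; for instance $G=\mathbb Z$ or $G=\mathbb Z/2$). Integers are read as degrees via the degree-one element. Let $\mathcal C$ be a $G$-graded cohomologically unital $A_\infty$ category over $\mathbb K$, and let $\mathrm{perf}(\mathcal C)\supset\mathcal C$ be its pre-triangulated split-closure: a $G$-graded cohomologically unital $A_\infty$ category containing $\mathcal C$ as a full subcategory, having a zero object, shifts and mapping cones, in which idempotents of the degree-zero cohomology category split, and which is split-generated by $\mathcal C$. For an $A_\infty$ category $\mathcal B$, let $\mathcal B_\Delta$ be the diagonal bimodule, $Y_{K,L}=\hom_{\mathcal B}(-,L)\otimes_{\mathbb K}\hom_{\mathcal B}(K,-)$ the Yoneda bimodules, and $\mathcal B^!$ the inverse dualizing bimodule, $\mathcal B^!(K,L)=\hom_{\mathcal B-\mathcal B}(\mathcal B_\Delta,Y_{K,L})$. **Copairing shadows.** Let $n\in\mathbb Z$ and let $f:\mathcal C_\Delta\to\mathcal C^![n]$ be a closed morphism of $A_\infty$ bimodules, that is, a closed morphism $\mathcal C_\Delta\to\mathcal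 C^!$ of degree $n$. For objects $K,L$ of $\mathcal C$, with cohomological units $\mathrm{id}_K$ and $\mathrm{id}_L$, the copairing shadow of $f$ is $$c^f_{K,L}=\big[(f_{L,L}(\mathrm{id}_L))_{K,K}(\mathrm{id}_K)\big]\in H^*(\hom(K,L))\otimes_{\mathbb K}H^*(\hom(L,K)).$$ By Morita invariance, $f$ corresponds to a closed morphism $F:\mathrm{perf}(\mathcal C)_\Delta\to\mathrm{perf}(\mathcal C)^!$ of degree $n$, whose restriction to $\mathcal C$, composed with the restriction map $\mathrm{perf}(\mathcal C)^!|_{\mathcal C}\to\mathcal C^!$, is homotopic to $f$. For $K,L\in\mathrm{perf}(\mathcal C)$, $c^f_{K,L}$ is defined by the same formula with $F$ in place of $f$. Write $c^f_L=c^f_{L,L}$. **Algebraic openness.** A copairing $c\in A\otimes A$ on a unital algebra $A$ is entirely degenerate if every element of the image of $c^*:A^\vee\to A$, $\phi\mapsto(\phi\otimes\mathrm{id})(c)$, is nilpotent. An object $L\in\mathrm{perf}(\mathcal C)$ is algebraically open with respect to $c_L\in H^*(\hom(L,L))^{\otimes2}$ if $c_L$ is entirely degenerate on the algebra $H^*(\hom(L,L))$.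 An object $K$ is an idempotent summand of $L$ if there are degree-zero classes $[i]\in H^0(\hom(K,L))$ and $[p]\in H^0(\hom(L,K))$ with $[p]\circ[i]=[\mathrm{id}_K]$. **Lemma.** 1. Let $\{c^f_{K,L}\}_{K,L\in\mathrm{perf}(\mathcal C)}$ be the copairing shadows of any closed bimodule morphism $f:\mathcal C_\Delta\to\mathcal C^![n]$. If $L\in\mathrm{perf}(\mathcal C)$ is algebraically open with respect to $c^f_L$ and $K$ is an idempotent summand of $L$ in $\mathrm{perf}(\mathcal C)$, then $K$ is algebraically open with respect to $c^f_K$. 2. In particular, suppose that $\mathcal C$ is smooth (its diagonal bimodule is split-generated by Yoneda bimodules) and let $\sigma\in HH_{-n}(\mathcal C)$ be a weak smooth Calabi–Yau structure, i.e. the morphism $ev(\sigma):\mathcal C^![n]\to\mathcal C_\Delta$ given by capping with $\sigma$ is an isomorphism in cohomology. Let $c^\sigma_{K,L}=c^{ev(\sigma)^{-1}}_{K,L}$ be the algebraic open-string copairings for $K,L\in\mathrm{perf}(\mathcal C)$. If $L\in\mathrm{perf}(\mathcal C)$ is algebraically open with respect to $c^\sigma_L$, then every idempotent summand $K$ of $L$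 in $\mathrm{perf}(\mathcal C)$ is algebraically open with respect to $c^\sigma_K$. -/

import Mathlib

universe u v w w₁ w₂ w₃

noncomputable section

open scoped DirectSum TensorProduct

set_option linter.unusedSectionVars false
set_option linter.unusedVariables false
set_option linter.checkUnivs false

namespace OpenString

/-- A grading group: an abelian group with a distinguished degree-one element and a parity
homomorphism. The groups `ℤ` and `ℤ/2` with their obvious data are the basic examples. -/
class GradingDatum (G : Type) extends AddCommGroup G where
  unit : G
  parity : G →+ ZMod 2
  parity_unit : parity unit = 1

/-- the degree-one element -/
abbrev deg1 (G : Type) [GradingDatum G] : G := GradingDatum.unit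

/-- the sign `(-1)^x` -/
def ksgn (x : ZMod 2) : ℤ := if x = 0 then 1 else -1

/-- the parity of a degree -/
def par {G : Type} [GradingDatum G] (g : G) : ZMod 2 := GradingDatum.parity g

/-! ### Graded vector spaces -/

structure GrMod (K : Type v) [Field K] (G : Type) where
  V : G → Type w
  [acg : ∀ g, AddCommGroup (V g)]
  [mod : ∀ g, Module K (V g)]

attribute [instance] GrMod.acg GrMod.mod

section Graded

variable {K : Type v} [Field K] {G : Type} [GradingDatum G] [DecidableEq G]

/-- The total space `⨁ g, A^g`. -/
abbrev GrMod.Tot (A : GrMod.{v, w} K G) : Type w := ⨁ g, A.V g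

/-- The inclusion of the degree `g` part. -/
def GrMod.inj (A : GrMod.{v, w} K G) (g : G) : A.V g →ₗ[K] A.Tot := DirectSum.lof K G A.V g

/-- Multiplication by `(-1)^(x·|a|)`. -/
def GrMod.tw (A : GrMod.{v, w} K G) (x : ZMod 2) : A.Tot →ₗ[K] A.Tot :=
  DirectSum.toModule K G _ fun g => ksgn (x * par g) • A.inj g

/-- Linear maps of degree `k`. -/
def HDeg (A : GrMod.{v, w₁} K G) (B : GrMod.{v, w₂} K G) (k : G) :
    Submodule K (A.Tot →ₗ[K] B.Tot) where
  carrier := {α | ∀ g a, α (A.inj g a) ∈ LinearMap.range (B.inj (g + k))}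
  add_mem' h h' g a := Submodule.add_mem _ (h g a) (h' g a)
  zero_mem' _ _ := Submodule.zero_mem _
  smul_mem' c _ h g a := Submodule.smul_mem _ c (h g a)

/-- The graded tensor product: in degree `k` it is `⨁_{i+j=k} A^i ⊗ B^j`. -/
def tens (A : GrMod.{v, w} K G) (B : GrMod.{v, w} K G) : GrMod.{v, w} K G where
  V k := ⨁ ij : {ij : G × G // ij.1 + ij.2 = k}, A.V ij.1.1 ⊗[K] B.V ij.1.2

/-- A family of bilinear maps on `A^i × B^j` induces a linear map on the total space of `A ⊗ B`. -/
def tlift {A B : GrMod.{v, w} K G} {W : Type w₁} [AddCommGroup W] [Module K W]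
    (f : ∀ i j, A.V i →ₗ[K] B.V j →ₗ[K] W) : (tens A B).Tot →ₗ[K] W :=
  DirectSum.toModule K G _ fun _ => DirectSum.toModule K _ _ fun ij =>
    TensorProduct.lift (f ij.1.1 ij.1.2)

/-- The element `a ⊗ b` for homogeneous `a` and `b`. -/
def tmk₀ (A B : GrMod.{v, w} K G) (i j : G) : A.V i →ₗ[K] B.V j →ₗ[K] (tens A B).Tot :=
  (TensorProduct.mk K (A.V i) (B.V j)).compr₂
    ((tens A B).inj (i + j) ∘ₗ
      DirectSum.lof K {ij : G × G // ij.1 + ij.2 = i + j}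
        (fun ij => A.V ij.1.1 ⊗[K] B.V ij.1.2) ⟨(i, j), rfl⟩)

/-- The element `a ⊗ b`. -/
def tmk (A B : GrMod.{v, w} K G) : A.Tot →ₗ[K] B.Tot →ₗ[K] (tens A B).Tot :=
  DirectSum.toModule K G _ fun i => LinearMap.flip <|
    DirectSum.toModule K G _ fun j => LinearMap.flip (tmk₀ A B i j)

/-- The map `α ⊗ β`, without sign. -/
def tmap {A B A' B' : GrMod.{v, w} K G} (α : A.Tot →ₗ[K] A'.Tot) (β : B.Tot →ₗ[K] B'.Tot) :
    (tens A B).Tot →ₗ[K] (tens A' B').Tot :=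
  tlift fun i j => (tmk A' B').compl₁₂ (α ∘ₗ A.inj i) (β ∘ₗ B.inj j)

theorem HDeg.comp_mem {A : GrMod.{v, w₁} K G} {B : GrMod.{v, w₂} K G} {D : GrMod.{v, w₃} K G}
    {j k l : G} {α : A.Tot →ₗ[K] B.Tot} {β : B.Tot →ₗ[K] D.Tot}
    (hβ : β ∈ HDeg B D j) (hα : α ∈ HDeg A B k) (h : l = j + k) : β ∘ₗ α ∈ HDeg A D l := by
  intro g a
  obtain ⟨b, hb⟩ := hα g a
  have := hβ _ b
  rw [LinearMap.comp_apply, ← hb]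
  have e : g + l = g + k + j := by rw [h]; abel
  rw [e]; exact this

theorem HDeg.id_mem (A : GrMod.{v, w₁} K G) : LinearMap.id ∈ HDeg A A 0 := by
  intro g a
  rw [add_zero]
  exact ⟨a, rfl⟩

theorem GrMod.tw_inj (A : GrMod.{v, w} K G) (x : ZMod 2) (g : G) (a : A.V g) :
    A.tw x (A.inj g a) = ksgn (x * par g) • A.inj g a := by
  simp [GrMod.tw, GrMod.inj]

theorem HDeg.tw_mem (A : GrMod.{v, w₁} K G) (x : ZMod 2) : A.tw x ∈ HDeg A A 0 := by
  intro g a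
  rw [GrMod.tw_inj, add_zero]
  exact zsmul_mem (LinearMap.mem_range_self (A.inj g) a) _

theorem tmk_inj (A B : GrMod.{v, w} K G) (i j : G) (a : A.V i) (b : B.V j) :
    tmk A B (A.inj i a) (B.inj j b) = tmk₀ A B i j a b := by
  simp [tmk, GrMod.inj]

theorem tmk_mem (A B : GrMod.{v, w} K G) {i j : G} {a : A.Tot} {b : B.Tot}
    (ha : a ∈ LinearMap.range (A.inj i)) (hb : b ∈ LinearMap.range (B.inj j)) :
    tmk A B a b ∈ LinearMap.range ((tens A B).inj (i + j)) := by
  obtain ⟨a, rfl⟩ := ha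
  obtain ⟨b, rfl⟩ := hb
  rw [tmk_inj]
  exact ⟨_, rfl⟩

theorem tlift_tmk₀ {A B : GrMod.{v, w} K G} {W : Type w₁} [AddCommGroup W] [Module K W]
    (f : ∀ i j, A.V i →ₗ[K] B.V j →ₗ[K] W) (i j : G) (a : A.V i) (b : B.V j) :
    tlift f (tmk₀ A B i j a b) = f i j a b := by
  simp only [tlift, tmk₀, GrMod.inj, LinearMap.compr₂_apply, TensorProduct.mk_apply]
  erw [DirectSum.toModule_lof, DirectSum.toModule_lof]
  simp

theorem tens_ext {A B : GrMod.{v, w} K G} {W : Type w₁} [AddCommGroup W] [Module K W]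
    {f f' : (tens A B).Tot →ₗ[K] W}
    (h : ∀ i j a b, f (tmk₀ A B i j a b) = f' (tmk₀ A B i j a b)) : f = f' := by
  refine DirectSum.linearMap_ext K fun k => ?_
  refine DirectSum.linearMap_ext K (M := fun ij : {ij : G × G // ij.1 + ij.2 = k} =>
    A.V ij.1.1 ⊗[K] B.V ij.1.2) fun ij => ?_
  obtain ⟨⟨i, j⟩, hij⟩ := ij
  dsimp only at hij
  subst hij
  exact TensorProduct.ext' fun a b => h i j a b

theorem tmap_tmk₀ {A B A' B' : GrMod.{v, w} K G} (α : A.Tot →ₗ[K] A'.Tot)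
    (β : B.Tot →ₗ[K] B'.Tot) (i j : G) (a : A.V i) (b : B.V j) :
    tmap α β (tmk₀ A B i j a b) = tmk A' B' (α (A.inj i a)) (β (B.inj j b)) := by
  rw [tmap, tlift_tmk₀]; rfl

/-- `α ⊗ β` as a bilinear function of `α` and `β`. -/
def tmapLin (A B A' B' : GrMod.{v, w} K G) :
    (A.Tot →ₗ[K] A'.Tot) →ₗ[K] (B.Tot →ₗ[K] B'.Tot) →ₗ[K]
      ((tens A B).Tot →ₗ[K] (tens A' B').Tot) :=
  LinearMap.mk₂ K tmap
    (fun _ _ _ => tens_ext fun _ _ _ _ => by simp [tmap_tmk₀])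
    (fun _ _ _ => tens_ext fun _ _ _ _ => by simp [tmap_tmk₀])
    (fun _ _ _ => tens_ext fun _ _ _ _ => by simp [tmap_tmk₀])
    (fun _ _ _ => tens_ext fun _ _ _ _ => by simp [tmap_tmk₀])

theorem tmap_mem {A B A' B' : GrMod.{v, w} K G} {j k l : G}
    {α : A.Tot →ₗ[K] A'.Tot} {β : B.Tot →ₗ[K] B'.Tot} (hα : α ∈ HDeg A A' j)
    (hβ : β ∈ HDeg B B' k) (h : l = j + k) : tmap α β ∈ HDeg (tens A B) (tens A' B') l := by
  intro g t
  suffices hs : ⊤ ≤ (LinearMap.range ((tens A' B').inj (g + l))).comap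
      (tmap α β ∘ₗ (tens A B).inj g) from hs (Submodule.mem_top (x := t))
  have key : ∀ t : ⨁ ij : {ij : G × G // ij.1 + ij.2 = g}, A.V ij.1.1 ⊗[K] B.V ij.1.2,
      (show (tens A B).V g from t) ∈ (LinearMap.range ((tens A' B').inj (g + l))).comap
        (tmap α β ∘ₗ (tens A B).inj g) := by
    intro t
    induction t using DirectSum.induction_on with
    | zero => exact Submodule.zero_mem _
    | add x y hx hy => exact Submodule.add_mem _ hx hy
    | of ij t =>
      induction t with
      | zero =>
        rw [map_zero]
        exact Submodule.zero_mem _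
      | add x y hx hy => rw [map_add]; exact Submodule.add_mem _ hx hy
      | tmul a b =>
        obtain ⟨⟨i, j'⟩, hij⟩ := ij
        dsimp only at hij
        subst hij
        have e : tmap α β (tmk₀ A B i j' a b) = tmk A' B' (α (A.inj i a)) (β (B.inj j' b)) := by
          rw [tmap, tlift_tmk₀]; rfl
        have h2 := tmk_mem A' B' (hα i a) (hβ j' b)
        rw [← e] at h2
        have e' : i + j + (j' + k) = i + j' + l := by rw [h]; abel
        rw [e'] at h2
        exact h2
  exact fun t _ => key t

/-! ### Composable paths -/

variable {O : Type u}

/-- Composable strings `(a₁, …, a_k)` of homogeneous elements `a_i ∈ Hom(X_{i-1}, X_i)`, from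
`X = X₀` to `Y = X_k`. -/
inductive Pth (H : O → O → GrMod.{v, w} K G) : O → O → Type (max u w)
  | nil (X : O) : Pth H X X
  | cons {X Y Z : O} (g : G) (a : (H X Y).V g) (p : Pth H Y Z) : Pth H X Z

namespace Pth

variable {H : O → O → GrMod.{v, w} K G}

/-- Concatenation. -/
def append : ∀ {X Y Z : O}, Pth H X Y → Pth H Y Z → Pth H X Z
  | _, _, _, nil _, q => q
  | _, _, _, cons g a p, q => cons g a (append p q)

/-- The reduced degree `∑ (|a_i| - 1)`. -/
def rdeg : ∀ {X Y : O}, Pth H X Y → G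
  | _, _, nil _ => 0
  | _, _, cons g _ p => (g - deg1 G) + rdeg p

/-- The sum `∑ F(p₁, p₂)` over all decompositions `p = p₁ p₂` (including empty pieces). -/
def splitSum {W : Type w₁} [AddCommGroup W] :
    ∀ {X Y : O} (_ : Pth H X Y) (_ : ∀ Z, Pth H X Z → Pth H Z Y → W), W
  | X, _, nil _, F => F X (nil X) (nil X)
  | X, _, cons g a p, F => F X (nil X) (cons g a p) + splitSum p fun Z l r => F Z (cons g a l) r

/-- The sum `∑ (-1)^{‖p₁‖} F(p₁ · z(p₂) · p₃)` over all decompositions `p = p₁ p₂ p₃`, where `z(p₂)`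
has reduced degree `‖p₂‖ + 1`. -/
def barSum {W : Type w₁} [AddCommGroup W] (z : ∀ {X Y : O}, Pth H X Y → (H X Y).Tot) {X Y : O}
    (F : Pth H X Y → W) (p : Pth H X Y) : W :=
  splitSum p fun _ l p₃ => splitSum l fun _ p₁ p₂ =>
    ksgn (par p₁.rdeg) •
      F (p₁.append (cons (p₂.rdeg + deg1 G + deg1 G) (z p₂ (p₂.rdeg + deg1 G + deg1 G)) p₃))

@[simp] theorem nil_append {X Y : O} (p : Pth H X Y) : (nil X).append p = p := rfl

@[simp] theorem cons_append {X Y Z T : O} (g : G) (a : (H X Y).V g) (p : Pth H Y Z)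
    (q : Pth H Z T) : (cons g a p).append q = cons g a (p.append q) := rfl

theorem append_assoc {X Y Z T : O} (p : Pth H X Y) (q : Pth H Y Z) (r : Pth H Z T) :
    (p.append q).append r = p.append (q.append r) := by
  induction p with
  | nil => rfl
  | cons g a p ih => simp [ih]

@[simp] theorem rdeg_append {X Y Z : O} (p : Pth H X Y) (q : Pth H Y Z) :
    (p.append q).rdeg = p.rdeg + q.rdeg := by
  induction p with
  | nil => simp [rdeg]
  | cons g a p ih => simp [rdeg, ih, add_assoc]

/-- Multilinearity of a function of paths, in every entry. -/
def PLin {W : Type w₁} [AddCommGroup W] [Module K W] {X Y : O} (F : Pth H X Y → W) : Prop :=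
  ∀ (A B : O) (s : Pth H X A) (t : Pth H B Y) (g : G),
    ∃ L : (H A B).V g →ₗ[K] W, ∀ a, F (s.append (cons g a t)) = L a

section

variable {W : Type w₁} [AddCommGroup W] [Module K W] {W' : Type w₂} [AddCommGroup W'] [Module K W']

theorem splitSum_append_cons {X A B Y : O} (s : Pth H X A) (g : G) (a : (H A B).V g)
    (t : Pth H B Y) (F : ∀ Z, Pth H X Z → Pth H Z Y → W) :
    splitSum (s.append (cons g a t)) F =
      splitSum s (fun Z l r => F Z l (r.append (cons g a t))) +
        splitSum t (fun Z l r => F Z (s.append (cons g a l)) r) := by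
  induction s with
  | nil => rfl
  | cons h b s ih => simp only [splitSum, cons_append, ih, add_assoc]

theorem splitSum_mem {S : Type w₃} [SetLike S W] [AddSubmonoidClass S W] (R : S) {X Y : O}
    (p : Pth H X Y) (F : ∀ Z, Pth H X Z → Pth H Z Y → W)
    (h : ∀ Z l r, l.append r = p → F Z l r ∈ R) : splitSum p F ∈ R := by
  induction p with
  | nil => exact h _ _ _ rfl
  | cons g a p ih =>
    exact add_mem (h _ _ _ rfl) (ih _ fun Z l r e => h _ _ _ (by rw [cons_append, e]))

theorem splitSum_add {X Y : O} (p : Pth H X Y) (F F' : ∀ Z, Pth H X Z → Pth H Z Y → W) :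
    splitSum p (fun Z l r => F Z l r + F' Z l r) = splitSum p F + splitSum p F' := by
  induction p with
  | nil => rfl
  | cons g a p ih => simp only [splitSum, ih]; abel

theorem splitSum_map (f : W →+ W') {X Y : O} (p : Pth H X Y)
    (F : ∀ Z, Pth H X Z → Pth H Z Y → W) :
    splitSum p (fun Z l r => f (F Z l r)) = f (splitSum p F) := by
  induction p with
  | nil => rfl
  | cons g a p ih => simp only [splitSum, ih, map_add]

theorem splitSum_lin {V : Type w₃} [AddCommGroup V] [Module K V] {X Y : O} (p : Pth H X Y)
    (F : V → ∀ Z, Pth H X Z → Pth H Z Y → W)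
    (h : ∀ Z l r, ∃ L : V →ₗ[K] W, ∀ a, F a Z l r = L a) :
    ∃ L : V →ₗ[K] W, ∀ a, splitSum p (F a) = L a := by
  induction p with
  | nil => exact h _ _ _
  | cons g a p ih =>
    obtain ⟨L, hL⟩ := h _ (nil _) (cons g a p)
    obtain ⟨L', hL'⟩ := ih (fun b Z l r => F b Z (cons g a l) r) fun Z l r => h _ _ _
    exact ⟨L + L', fun b => by simp only [splitSum, hL, hL', LinearMap.add_apply]⟩

theorem barSum_mem {S : Type w₃} [SetLike S W] [AddSubgroupClass S W] (R : S)
    (z : ∀ {X Y : O}, Pth H X Y → (H X Y).Tot) {X Y : O}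
    (F : Pth H X Y → W) (p : Pth H X Y)
    (h : ∀ q : Pth H X Y, q.rdeg = p.rdeg + deg1 G → F q ∈ R) : barSum z F p ∈ R := by
  refine splitSum_mem R p _ fun Z l r e => splitSum_mem R l _ fun Z' l₁ l₂ e' => zsmul_mem (h _ ?_) _
  rw [← e, ← e']
  simp only [rdeg_append, rdeg]
  abel

theorem barSum_add (z : ∀ {X Y : O}, Pth H X Y → (H X Y).Tot) {X Y : O}
    (F F' : Pth H X Y → W) (p : Pth H X Y) :
    barSum z (fun q => F q + F' q) p = barSum z F p + barSum z F' p := by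
  simp only [barSum, smul_add, splitSum_add]

theorem barSum_map (f : W →+ W') (z : ∀ {X Y : O}, Pth H X Y → (H X Y).Tot) {X Y : O}
    (F : Pth H X Y → W) (p : Pth H X Y) :
    barSum z (fun q => f (F q)) p = f (barSum z F p) := by
  simp only [barSum, ← map_zsmul, splitSum_map]

theorem PLin.map {X Y : O} {F : Pth H X Y → W} (h : PLin F) (f : W →ₗ[K] W') :
    PLin fun p => f (F p) := fun A B s t g => by
  obtain ⟨L, hL⟩ := h A B s t g
  exact ⟨f ∘ₗ L, fun a => by simp [hL]⟩

theorem PLin.add {X Y : O} {F F' : Pth H X Y → W} (h : PLin F) (h' : PLin F') :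
    PLin fun p => F p + F' p := fun A B s t g => by
  obtain ⟨L, hL⟩ := h A B s t g
  obtain ⟨L', hL'⟩ := h' A B s t g
  exact ⟨L + L', fun a => by simp [hL, hL']⟩

theorem PLin.zero {X Y : O} : PLin (fun _ : Pth H X Y => (0 : W)) :=
  fun _ _ _ _ _ => ⟨0, fun _ => rfl⟩

theorem PLin.zsmul {X Y : O} {F : Pth H X Y → W} (h : PLin F) (n : ℤ) :
    PLin fun p => n • F p := fun A B s t g => by
  obtain ⟨L, hL⟩ := h A B s t g
  exact ⟨n • L, fun a => by simp [hL]⟩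

theorem PLin.neg {X Y : O} {F : Pth H X Y → W} (h : PLin F) :
    PLin fun p => - F p := fun A B s t g => by
  obtain ⟨L, hL⟩ := h A B s t g
  exact ⟨-L, fun a => by simp [hL]⟩

theorem PLin.smul {X Y : O} {F : Pth H X Y → W} (h : PLin F) (c : K) :
    PLin fun p => c • F p := h.map (c • LinearMap.id)

/-- Coefficients depending on the degree of the path do not affect multilinearity. -/
theorem PLin.dep {X Y : O} {E : G → Pth H X Y → W} (h : ∀ k, PLin (E k)) :
    PLin fun p => E p.rdeg p := fun A B s t g => by
  obtain ⟨L, hL⟩ := h (s.rdeg + (g - deg1 G + t.rdeg)) A B s t g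
  exact ⟨L, fun a => by simp [hL, rdeg]⟩

theorem PLin.append_left {X Y Z : O} {F : Pth H X Z → W} (h : PLin F) (q : Pth H Y Z) :
    PLin fun p : Pth H X Y => F (p.append q) := fun A B s t g => by
  obtain ⟨L, hL⟩ := h A B s (t.append q) g
  exact ⟨L, fun a => by simp [append_assoc, hL]⟩

theorem PLin.append_right {X Y Z : O} {F : Pth H X Z → W} (h : PLin F) (p : Pth H X Y) :
    PLin fun q : Pth H Y Z => F (p.append q) := fun A B s t g => by
  obtain ⟨L, hL⟩ := h A B (p.append s) t g
  exact ⟨L, fun a => by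
    change F (p.append (s.append (cons g a t))) = L a
    rw [← append_assoc, hL]⟩

theorem PLin.cons_right {X Y Z : O} {F : Pth H X Z → W} (h : PLin F) (g : G) (b : (H X Y).V g) :
    PLin fun q : Pth H Y Z => F (cons g b q) := h.append_right (cons g b (nil _))

theorem PLin.splitSum {X Y : O} {F : ∀ Z, Pth H X Z → Pth H Z Y → W}
    (h₁ : ∀ Z r, PLin fun l => F Z l r) (h₂ : ∀ Z l, PLin fun r => F Z l r) :
    PLin fun p => Pth.splitSum p F := fun A B s t g => by
  obtain ⟨L, hL⟩ := splitSum_lin (K := K) s (fun a Z l r => F Z l (r.append (cons g a t)))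
    fun Z l r => h₂ Z l A B r t g
  obtain ⟨L', hL'⟩ := splitSum_lin (K := K) t (fun a Z l r => F Z (s.append (cons g a l)) r)
    fun Z l r => h₁ Z r A B s l g
  exact ⟨L + L', fun a => by
    change Pth.splitSum (s.append (cons g a t)) F = _
    rw [splitSum_append_cons, hL, hL', LinearMap.add_apply]⟩

theorem PLin.barSum {z : ∀ {X Y : O}, Pth H X Y → (H X Y).Tot}
    (hz : ∀ {X Y : O}, PLin (z : Pth H X Y → (H X Y).Tot)) {X Y : O}
    {F : Pth H X Y → W} (h : PLin F) : PLin (barSum z F) := by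
  have key : ∀ (Z Z' : O) (r : Pth H Z Y) (l₁ : Pth H X Z') (k : G),
      ∃ L : (H Z' Z).Tot →ₗ[K] W, ∀ y, F (l₁.append (cons k (y k) r)) = L y := by
    intro Z Z' r l₁ k
    obtain ⟨L, hL⟩ := h Z' Z l₁ r k
    exact ⟨L ∘ₗ DirectSum.component K G _ k, fun y => by rw [hL]; rfl⟩
  refine PLin.splitSum (fun Z r => PLin.splitSum (fun Z' l₂ => ?_) fun Z' l₁ => ?_) fun Z l => ?_
  · exact PLin.dep (E := fun k l₁ => ksgn (par k) • F (l₁.append _))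
      fun k => (h.append_left _).zsmul _
  · refine PLin.zsmul (PLin.dep (E := fun k l₂ => F (l₁.append (cons (k + deg1 G + deg1 G)
      (z l₂ (k + deg1 G + deg1 G)) r))) fun k => ?_) _
    obtain ⟨L, hL⟩ := key Z Z' r l₁ (k + deg1 G + deg1 G)
    simp only [hL]
    exact hz.map L
  · intro A B s t g
    refine splitSum_lin (K := K) l _ fun Z' l₁ l₂ => ?_
    obtain ⟨L, hL⟩ := (((h.append_right l₁).cons_right _ _).zsmul (ksgn (par l₁.rdeg))) A B s t g
    exact ⟨L, hL⟩

/-- The linear map obtained by varying one entry. -/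
def PLin.toLin {X Y : O} {F : Pth H X Y → W} (h : PLin F) {A B : O} (s : Pth H X A)
    (t : Pth H B Y) (g : G) : (H A B).V g →ₗ[K] W where
  toFun a := F (s.append (cons g a t))
  map_add' a b := by obtain ⟨L, hL⟩ := h A B s t g; simp [hL]
  map_smul' c a := by obtain ⟨L, hL⟩ := h A B s t g; simp [hL]

/-- The same map, extended linearly to inhomogeneous elements. -/
def PLin.toTot {X Y : O} {F : Pth H X Y → W} (h : PLin F) {A B : O} (s : Pth H X A)
    (t : Pth H B Y) : (H A B).Tot →ₗ[K] W :=
  DirectSum.toModule K G _ fun g => h.toLin s t g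

theorem PLin.toTot_inj {X Y : O} {F : Pth H X Y → W} (h : PLin F) {A B : O} (s : Pth H X A)
    (t : Pth H B Y) (g : G) (a : (H A B).V g) :
    h.toTot s t ((H A B).inj g a) = F (s.append (cons g a t)) := by
  simp [PLin.toTot, GrMod.inj, PLin.toLin]

theorem PLin.toTot_of_mem {X Y : O} {F : Pth H X Y → W} (h : PLin F) {A B : O} (s : Pth H X A)
    (t : Pth H B Y) {k : G} {z : (H A B).Tot} (hz : z ∈ LinearMap.range ((H A B).inj k)) :
    F (s.append (cons k (z k) t)) = h.toTot s t z := by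
  obtain ⟨a, rfl⟩ := hz
  rw [h.toTot_inj, GrMod.inj, DirectSum.lof_apply]

end

end Pth

set_option linter.checkUnivs false

/-! ### A∞ categories -/

/-- The data of objects, graded morphism spaces and operations `μ(a₁, …, a_k)` on composable
strings; `μ(a₁, …, a_k)` is `μ^k(a_k, …, a₁)` in the usual right-to-left notation. -/
structure AInfPre (K : Type v) [Field K] (G : Type) [GradingDatum G] [DecidableEq G] where
  Obj : Type u
  Hom : Obj → Obj → GrMod.{v, w} K G
  μ : ∀ {X Y : Obj}, Pth Hom X Y → (Hom X Y).Tot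

open Pth

namespace AInfPre

variable (C : AInfPre.{u, v, w} K G)

/-- `μ` as a function of a single homogeneous element, of two, and of three. -/
def μ₁ {X Y : C.Obj} {g : G} (a : (C.Hom X Y).V g) : (C.Hom X Y).Tot :=
  C.μ (cons g a (nil Y))

def μ₂ {X Y Z : C.Obj} {g h : G} (a : (C.Hom X Y).V g) (b : (C.Hom Y Z).V h) : (C.Hom X Z).Tot :=
  C.μ (cons g a (cons h b (nil Z)))

def μ₃ {X Y Z T : C.Obj} {g h k : G} (a : (C.Hom X Y).V g) (b : (C.Hom Y Z).V h)
    (c : (C.Hom Z T).V k) : (C.Hom X T).Tot :=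
  C.μ (cons g a (cons h b (cons k c (nil T))))

/-- `e` is a cohomological unit: a degree-zero cocycle which acts on both sides as the identity
in cohomology, where the cohomological composition is `[b] ∘ [a] = (-1)^{|a|} [μ²(b, a)]`. -/
def IsCohUnit (X : C.Obj) (e : (C.Hom X X).V 0) : Prop :=
  C.μ₁ e = 0 ∧
  (∀ (Y : C.Obj) (g : G) (a : (C.Hom X Y).V g), C.μ₁ a = 0 →
    ∃ b : (C.Hom X Y).V (g - deg1 G), C.μ₂ e a = (C.Hom X Y).inj g a + C.μ₁ b) ∧
  (∀ (Y : C.Obj) (g : G) (a : (C.Hom Y X).V g), C.μ₁ a = 0 →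
    ∃ b : (C.Hom Y X).V (g - deg1 G), ksgn (par g) • C.μ₂ a e = (C.Hom Y X).inj g a + C.μ₁ b)

end AInfPre

/-- Cohomologically unital A∞ categories over `K`. The relations are
`∑ (-1)^{‖a₁‖ + … + ‖a_i‖} μ(a₁, …, a_i, μ(a_{i+1}, …, a_j), a_{j+1}, …, a_k) = 0`. -/
structure AInfCat (K : Type v) [Field K] (G : Type) [GradingDatum G] [DecidableEq G] extends
    AInfPre.{u, v, w} K G where
  μ_nil : ∀ X : Obj, μ (nil X) = 0
  μ_lin : ∀ {X Y : Obj}, PLin (μ : Pth Hom X Y → (Hom X Y).Tot)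
  μ_deg : ∀ {X Y : Obj} (p : Pth Hom X Y),
    μ p ∈ LinearMap.range ((Hom X Y).inj (p.rdeg + deg1 G + deg1 G))
  rel : ∀ {X Y : Obj} (p : Pth Hom X Y), barSum μ (fun q => μ q) p = 0
  unital : ∀ X : Obj, ∃ e, toAInfPre.IsCohUnit X e

/-! ### Cohomology -/

namespace AInfCat

variable (C : AInfCat.{u, v, w} K G)

/-- The differential `μ^1` on the total morphism space. -/
def d (X Y : C.Obj) : (C.Hom X Y).Tot →ₗ[K] (C.Hom X Y).Tot := C.μ_lin.toTot (nil X) (nil Y)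

/-- Composition `b ∘ a = (-1)^{|a|} μ²(b, a)`. -/
def cmp (X Y Z : C.Obj) : (C.Hom Y Z).Tot →ₗ[K] (C.Hom X Y).Tot →ₗ[K] (C.Hom X Z).Tot :=
  DirectSum.toModule K G _ fun h =>
    { toFun := fun b => (C.μ_lin.toTot (nil X) (cons h b (nil Z))) ∘ₗ (C.Hom X Y).tw 1
      map_add' := fun b b' => by
        refine DirectSum.linearMap_ext K fun g => LinearMap.ext fun a => ?_
        have e : ∀ b, C.μ_lin.toTot (nil X) (cons h b (nil Z)) ((C.Hom X Y).inj g a) =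
          C.μ_lin.toLin (cons g a (nil Y)) (nil Z) h b := fun b => by
            rw [PLin.toTot_inj]; rfl
        change C.μ_lin.toTot _ _ ((C.Hom X Y).tw 1 ((C.Hom X Y).inj g a)) =
          C.μ_lin.toTot _ _ ((C.Hom X Y).tw 1 ((C.Hom X Y).inj g a)) +
          C.μ_lin.toTot _ _ ((C.Hom X Y).tw 1 ((C.Hom X Y).inj g a))
        simp only [GrMod.tw_inj, map_zsmul, e, map_add, smul_add]
      map_smul' := fun c b => by
        refine DirectSum.linearMap_ext K fun g => LinearMap.ext fun a => ?_
        have e : ∀ b, C.μ_lin.toTot (nil X) (cons h b (nil Z)) ((C.Hom X Y).inj g a) =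
          C.μ_lin.toLin (cons g a (nil Y)) (nil Z) h b := fun b => by
            rw [PLin.toTot_inj]; rfl
        change C.μ_lin.toTot _ _ ((C.Hom X Y).tw 1 ((C.Hom X Y).inj g a)) =
          c • C.μ_lin.toTot _ _ ((C.Hom X Y).tw 1 ((C.Hom X Y).inj g a))
        simp only [GrMod.tw_inj, map_zsmul, e, map_smul]
        rw [smul_comm] }

variable {C} in
theorem d_inj {X Y : C.Obj} {g : G} (a : (C.Hom X Y).V g) :
    C.d X Y ((C.Hom X Y).inj g a) = C.μ₁ a := by
  rw [d, PLin.toTot_inj]; rfl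

variable {C} in
theorem cmp_inj {X Y Z : C.Obj} {h : G} (b : (C.Hom Y Z).V h) (x : (C.Hom X Y).Tot) :
    C.cmp X Y Z ((C.Hom Y Z).inj h b) x =
      C.μ_lin.toTot (nil X) (cons h b (nil Z)) ((C.Hom X Y).tw 1 x) := by
  simp only [cmp, GrMod.inj, DirectSum.toModule_lof]; rfl

variable {C} in
theorem cmp_inj_inj {X Y Z : C.Obj} {g h : G} (b : (C.Hom Y Z).V h) (a : (C.Hom X Y).V g) :
    C.cmp X Y Z ((C.Hom Y Z).inj h b) ((C.Hom X Y).inj g a) = ksgn (par g) • C.μ₂ a b := by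
  rw [cmp_inj, GrMod.tw_inj, map_zsmul, PLin.toTot_inj, one_mul]; rfl

variable {C} in
theorem μ_ins {X A B Y : C.Obj} (s : Pth C.Hom X A) (p : Pth C.Hom A B) (t : Pth C.Hom B Y) :
    C.μ (s.append (cons (p.rdeg + deg1 G + deg1 G) (C.μ p (p.rdeg + deg1 G + deg1 G)) t)) =
      C.μ_lin.toTot s t (C.μ p) := C.μ_lin.toTot_of_mem s t (C.μ_deg p)

variable {C} in
theorem rel' {X Y : C.Obj} (p : Pth C.Hom X Y) :
    splitSum p (fun _ l p₃ => splitSum l fun _ p₁ p₂ =>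
      ksgn (par p₁.rdeg) • C.μ_lin.toTot p₁ p₃ (C.μ p₂)) = 0 := by
  rw [← C.rel p]
  unfold barSum
  congr; funext; congr; funext
  exact congrArg _ (μ_ins _ _ _).symm

variable {C} in
theorem rel₁ {X Y : C.Obj} {g : G} (a : (C.Hom X Y).V g) : C.d X Y (C.μ₁ a) = 0 := by
  have h := C.rel' (cons g a (nil Y))
  simp only [splitSum, C.μ_nil, map_zero, smul_zero, zero_add, add_zero] at h
  simpa [rdeg, par, ksgn, d, AInfPre.μ₁] using h

variable {C} in
theorem rel₂ {X Y Z : C.Obj} {g k : G} (a : (C.Hom X Y).V g) (b : (C.Hom Y Z).V k) :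
    C.μ_lin.toTot (nil X) (cons k b (nil Z)) (C.μ₁ a) + C.d X Z (C.μ₂ a b)
      + ksgn (par (g - deg1 G)) • C.μ_lin.toTot (cons g a (nil Y)) (nil Z) (C.μ₁ b) = 0 := by
  have h := C.rel' (cons g a (cons k b (nil Z)))
  simp only [splitSum, C.μ_nil, map_zero, smul_zero, zero_add, add_zero, rdeg] at h
  simpa [par, ksgn, add_assoc, d, AInfPre.μ₁, AInfPre.μ₂, AInfPre.μ₃] using h

variable {C} in
theorem rel₃ {X Y Z T : C.Obj} {g m k : G} (a : (C.Hom X Y).V g) (b : (C.Hom Y Z).V m)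
    (c : (C.Hom Z T).V k) (ha : C.μ₁ a = 0) (hb : C.μ₁ b = 0) (hc : C.μ₁ c = 0) :
    C.μ_lin.toTot (nil X) (cons k c (nil T)) (C.μ₂ a b) + C.d X T (C.μ₃ a b c)
      + ksgn (par (g - deg1 G)) • C.μ_lin.toTot (cons g a (nil Y)) (nil T) (C.μ₂ b c) = 0 := by
  have h := C.rel' (cons g a (cons m b (cons k c (nil T))))
  simp only [splitSum, C.μ_nil, map_zero, smul_zero, zero_add, add_zero, rdeg] at h
  simp only [AInfPre.μ₁] at ha hb hc
  simp only [ha, hb, hc, map_zero, smul_zero, zero_add, add_zero] at h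
  simpa [par, ksgn, add_assoc, d, AInfPre.μ₁, AInfPre.μ₂, AInfPre.μ₃] using h

theorem par_sub_deg1 (g : G) : par (g - deg1 G) = par g + 1 := by
  have h : (-1 : ZMod 2) = 1 := by decide
  rw [par, map_sub, deg1, GradingDatum.parity_unit, sub_eq_add_neg, h]; rfl

variable {C} in
theorem μ₁_mem {X Y : C.Obj} {g : G} (a : (C.Hom X Y).V g) :
    C.μ₁ a ∈ LinearMap.range ((C.Hom X Y).inj (g + deg1 G)) := by
  have h := C.μ_deg (cons g a (nil Y))
  have e : (cons g a (nil Y)).rdeg + deg1 G + deg1 G = g + deg1 G := by simp [rdeg]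
  rwa [e] at h

variable {C} in
theorem cmp_apply_inj {X Y Z : C.Obj} {g : G} (y : (C.Hom Y Z).Tot) (a : (C.Hom X Y).V g) :
    C.cmp X Y Z y ((C.Hom X Y).inj g a) =
      ksgn (par g) • C.μ_lin.toTot (cons g a (nil Y)) (nil Z) y := by
  induction y using DirectSum.induction_on with
  | zero => simp
  | add y y' h h' => rw [map_add, LinearMap.add_apply, h, h', map_add, smul_add]
  | of k b =>
    change C.cmp X Y Z ((C.Hom Y Z).inj k b) _ = _ • C.μ_lin.toTot _ _ ((C.Hom Y Z).inj k b)
    rw [cmp_inj_inj, PLin.toTot_inj]; rfl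

variable {C} in
/-- The Leibniz rule for the composition. -/
theorem d_cmp {X Y Z : C.Obj} (y : (C.Hom Y Z).Tot) (x : (C.Hom X Y).Tot) :
    C.d X Z (C.cmp X Y Z y x) =
      C.cmp X Y Z y (C.d X Y x) + C.cmp X Y Z (C.d Y Z y) ((C.Hom X Y).tw 1 x) := by
  induction y using DirectSum.induction_on with
  | zero => simp
  | add y y' h h' => simp only [map_add, LinearMap.add_apply, h, h']; abel
  | of k b =>
    change C.d X Z (C.cmp X Y Z ((C.Hom Y Z).inj k b) x) =
      C.cmp X Y Z ((C.Hom Y Z).inj k b) (C.d X Y x) +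
        C.cmp X Y Z (C.d Y Z ((C.Hom Y Z).inj k b)) ((C.Hom X Y).tw 1 x)
    induction x using DirectSum.induction_on with
    | zero => simp
    | add y y' h h' => simp only [map_add, h, h']; abel
    | of g a =>
      change C.d X Z (C.cmp X Y Z ((C.Hom Y Z).inj k b) ((C.Hom X Y).inj g a)) =
        C.cmp X Y Z ((C.Hom Y Z).inj k b) (C.d X Y ((C.Hom X Y).inj g a)) +
        C.cmp X Y Z (C.d Y Z ((C.Hom Y Z).inj k b)) ((C.Hom X Y).tw 1 ((C.Hom X Y).inj g a))
      rw [d_inj, d_inj, GrMod.tw_inj, map_zsmul, cmp_inj_inj, cmp_apply_inj, map_zsmul]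
      have h := rel₂ a b
      obtain ⟨a', ha'⟩ := μ₁_mem a
      rw [cmp_inj, ← ha', GrMod.tw_inj, map_zsmul, ha']
      have h1 : par (g + deg1 G) = par g + 1 := by
        simp [par, deg1, GradingDatum.parity_unit]
      rw [par_sub_deg1] at h
      rw [h1, one_mul, one_mul]
      have h2 : par g = 0 ∨ par g = 1 := by generalize par g = t; revert t; decide
      have h3 : ((1 : ZMod 2) + 1) = 0 := by decide
      rcases h2 with h2 | h2 <;> simp only [h2, h3, ksgn, zero_add, if_true, if_false,
        one_smul, neg_smul, neg_neg, one_ne_zero] at h ⊢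
      · rw [add_right_comm] at h
        have := eq_neg_of_add_eq_zero_right h
        rw [this]; abel
      · have := eq_neg_of_add_eq_zero_right ((add_right_comm _ _ _).symm.trans h)
        rw [this]; abel

/-- The cocycles in the total morphism space. -/
abbrev Z (X Y : C.Obj) : Submodule K (C.Hom X Y).Tot := LinearMap.ker (C.d X Y)

/-- The total cohomology `H^*(hom(X, Y))`. -/
abbrev H (X Y : C.Obj) : Type w := C.Z X Y ⧸ (LinearMap.range (C.d X Y)).submoduleOf (C.Z X Y)

/-- The class of a cocycle. -/
def cls (X Y : C.Obj) : C.Z X Y →ₗ[K] C.H X Y := Submodule.mkQ _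

variable {C}

theorem cls_surjective {X Y : C.Obj} : Function.Surjective (C.cls X Y) := Submodule.mkQ_surjective _

theorem cls_eq_zero {X Y : C.Obj} (z : C.Z X Y) :
    C.cls X Y z = 0 ↔ ∃ w, C.d X Y w = z := by
  rw [cls, Submodule.mkQ_apply, Submodule.Quotient.mk_eq_zero]; rfl

theorem d_tw {X Y : C.Obj} (x : (C.Hom X Y).Tot) :
    C.d X Y ((C.Hom X Y).tw 1 x) = - (C.Hom X Y).tw 1 (C.d X Y x) := by
  induction x using DirectSum.induction_on with
  | zero => simp
  | add y y' h h' => simp only [map_add, h, h']; abel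
  | of g a =>
    change C.d X Y ((C.Hom X Y).tw 1 ((C.Hom X Y).inj g a)) =
      - (C.Hom X Y).tw 1 (C.d X Y ((C.Hom X Y).inj g a))
    rw [GrMod.tw_inj, map_zsmul, d_inj]
    obtain ⟨a', ha'⟩ := μ₁_mem a
    rw [← ha', GrMod.tw_inj]
    have h1 : par (g + deg1 G) = par g + 1 := by
      simp [par, deg1, GradingDatum.parity_unit]
    have h2 : ∀ t : ZMod 2, ksgn (1 * t) = - ksgn (1 * (t + 1)) := by decide
    rw [h1, h2, neg_smul]

theorem d_cmp_cocycle {X Y Z : C.Obj} (y : C.Z Y Z) (x : C.Z X Y) :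
    C.cmp X Y Z y x ∈ C.Z X Z := by
  have hx : C.d X Y x = 0 := x.2
  have hy : C.d Y Z y = 0 := y.2
  rw [LinearMap.mem_ker, d_cmp, hx, hy]; simp

variable (C) in
/-- Composition of cocycles, with values in cohomology. -/
def cmpZ (X Y Z : C.Obj) : C.Z Y Z →ₗ[K] C.Z X Y →ₗ[K] C.H X Z :=
  LinearMap.mk₂ K (fun y x => C.cls X Z ⟨C.cmp X Y Z y x, d_cmp_cocycle y x⟩)
    (fun y y' x => by rw [← map_add]; congr 1; ext1; simp)
    (fun c y x => by rw [← map_smul]; congr 1; ext1; simp)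
    (fun y x x' => by rw [← map_add]; congr 1; ext1; simp)
    (fun c y x => by rw [← map_smul]; congr 1; ext1; simp)

theorem cmpZ_left {X Y Z : C.Obj} :
    (LinearMap.range (C.d Y Z)).submoduleOf (C.Z Y Z) ≤ LinearMap.ker (C.cmpZ X Y Z) := by
  rintro ⟨_, hy⟩ ⟨w, rfl⟩
  refine LinearMap.ext fun x => (cls_eq_zero _).2 ⟨C.cmp X Y Z w ((C.Hom X Y).tw 1 x), ?_⟩
  have hx : C.d X Y x = 0 := x.2
  have htw : ∀ x : (C.Hom X Y).Tot, (C.Hom X Y).tw 1 ((C.Hom X Y).tw 1 x) = x := by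
    intro x
    induction x using DirectSum.induction_on with
    | zero => simp
    | add y y' h h' => simp only [map_add, h, h']
    | of g a =>
      change (C.Hom X Y).tw 1 ((C.Hom X Y).tw 1 ((C.Hom X Y).inj g a)) = (C.Hom X Y).inj g a
      have h2 : ∀ t : ZMod 2, ksgn (1 * t) * ksgn (1 * t) = 1 := by decide
      rw [GrMod.tw_inj, map_zsmul, GrMod.tw_inj, smul_smul, h2, one_smul]
  rw [d_cmp, d_tw, hx, htw]; simp

theorem cmpZ_right {X Y Z : C.Obj} (y : C.Z Y Z) :
    (LinearMap.range (C.d X Y)).submoduleOf (C.Z X Y) ≤ LinearMap.ker (C.cmpZ X Y Z y) := by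
  rintro ⟨_, hx⟩ ⟨w, rfl⟩
  refine (cls_eq_zero _).2 ⟨C.cmp X Y Z y w, ?_⟩
  have hy : C.d Y Z y = 0 := y.2
  rw [d_cmp, hy]; simp

variable (C) in
/-- The cohomological composition `H^*(hom(Y, Z)) ⊗ H^*(hom(X, Y)) → H^*(hom(X, Z))`. -/
def hcmp (X Y Z : C.Obj) : C.H Y Z →ₗ[K] C.H X Y →ₗ[K] C.H X Z :=
  Submodule.liftQ _
    { toFun := fun y => Submodule.liftQ _ (C.cmpZ X Y Z y) (cmpZ_right y)
      map_add' := fun y y' => by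
        refine LinearMap.ext fun x => ?_
        obtain ⟨x, rfl⟩ := cls_surjective x
        simp [cls]
      map_smul' := fun c y => by
        refine LinearMap.ext fun x => ?_
        obtain ⟨x, rfl⟩ := cls_surjective x
        simp [cls] }
    (fun y hy => by
      refine LinearMap.ext fun x => ?_
      obtain ⟨x, rfl⟩ := cls_surjective x
      have h := cmpZ_left (X := X) hy
      rw [LinearMap.mem_ker] at h
      simp [cls, h])

theorem hcmp_cls {X Y Z : C.Obj} (y : C.Z Y Z) (x : C.Z X Y) :
    C.hcmp X Y Z (C.cls Y Z y) (C.cls X Y x) =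
      C.cls X Z ⟨C.cmp X Y Z y x, d_cmp_cocycle y x⟩ := rfl

/-- The class of a homogeneous cocycle. -/
def hom₀ {X Y : C.Obj} {g : G} (a : (C.Hom X Y).V g) (ha : C.μ₁ a = 0) : C.Z X Y :=
  ⟨(C.Hom X Y).inj g a, by rw [LinearMap.mem_ker, d_inj, ha]⟩

theorem μ₁_component {X Y : C.Obj} (z : C.Z X Y) (g : G) : C.μ₁ ((z : (C.Hom X Y).Tot) g) = 0 := by
  have key : ∀ z : (C.Hom X Y).Tot, (C.d X Y z) (g + deg1 G) = C.μ₁ (z g) (g + deg1 G) := by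
    intro z
    rw [← d_inj]
    induction z using DirectSum.induction_on with
    | zero => simp
    | add y y' h h' => simp only [map_add, DirectSum.add_apply, h, h']
    | of k a =>
      by_cases hk : k = g
      · subst hk
        change C.d X Y ((C.Hom X Y).inj k a) _ = C.d X Y ((C.Hom X Y).inj k _) _
        congr
        exact (DirectSum.of_eq_same (β := (C.Hom X Y).V) k a).symm
      · rw [DirectSum.of_eq_of_ne _ _ _ (Ne.symm hk)]
        change C.d X Y ((C.Hom X Y).inj k a) _ = _
        rw [d_inj]
        obtain ⟨a', ha'⟩ := μ₁_mem a
        rw [← ha', map_zero, map_zero]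
        exact DirectSum.of_eq_of_ne (β := (C.Hom X Y).V) _ _ _
          fun h => hk (add_right_cancel h.symm)
  have h := key z
  have hz : C.d X Y z = 0 := z.2
  rw [hz] at h
  obtain ⟨a', ha'⟩ := μ₁_mem ((z : (C.Hom X Y).Tot) g)
  rw [← ha'] at h ⊢
  have h3 : ((C.Hom X Y).inj (g + deg1 G) a') (g + deg1 G) = a' :=
    DirectSum.of_eq_same (β := (C.Hom X Y).V) _ a'
  rw [h3] at h
  rw [← h]
  exact map_zero _

theorem H_ind {X Y : C.Obj} {p : C.H X Y → Prop} (h0 : p 0) (hadd : ∀ x y, p x → p y → p (x + y))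
    (hc : ∀ (g : G) (a : (C.Hom X Y).V g) (ha : C.μ₁ a = 0), p (C.cls X Y (hom₀ a ha)))
    (x : C.H X Y) : p x := by
  classical
  obtain ⟨z, rfl⟩ := cls_surjective x
  have hz : z = ∑ g ∈ DFinsupp.support (z : (C.Hom X Y).Tot), hom₀ _ (μ₁_component z g) := by
    ext1
    rw [AddSubmonoidClass.coe_finsetSum]
    exact (DirectSum.sum_support_of (z : (C.Hom X Y).Tot)).symm
  rw [hz, map_sum]
  exact Finset.sum_induction _ p hadd h0 fun g _ => hc g _ _

theorem hcmp_assoc {X Y Z T : C.Obj} (z : C.H Z T) (y : C.H Y Z) (x : C.H X Y) :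
    C.hcmp X Z T z (C.hcmp X Y Z y x) = C.hcmp X Y T (C.hcmp Y Z T z y) x := by
  induction x using H_ind with
  | h0 => simp
  | hadd x x' h h' => simp only [map_add, h, h']
  | hc g a ha =>
  induction y using H_ind with
  | h0 => simp
  | hadd x x' h h' => simp only [map_add, LinearMap.add_apply, h, h']
  | hc m b hb =>
  induction z using H_ind with
  | h0 => simp
  | hadd x x' h h' => simp only [map_add, LinearMap.add_apply, h, h']
  | hc k c hc =>
    simp only [hcmp_cls]
    rw [← sub_eq_zero, ← map_sub, cls_eq_zero]
    refine ⟨-(ksgn (par m) • C.μ₃ a b c), ?_⟩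
    have h := rel₃ a b c ha hb hc
    have hab : C.μ₂ a b ∈ LinearMap.range ((C.Hom X Z).inj (g + m)) := by
      have h := C.μ_deg (cons g a (cons m b (nil Z)))
      have e : (cons g a (cons m b (nil Z))).rdeg + deg1 G + deg1 G = g + m := by
        simp only [rdeg]; abel
      rwa [e] at h
    obtain ⟨ab, hab⟩ := hab
    change _ = C.cmp X Z T ((C.Hom Z T).inj k c) (C.cmp X Y Z ((C.Hom Y Z).inj m b)
      ((C.Hom X Y).inj g a)) - C.cmp X Y T (C.cmp Y Z T ((C.Hom Z T).inj k c)
      ((C.Hom Y Z).inj m b)) ((C.Hom X Y).inj g a)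
    rw [cmp_inj_inj, cmp_inj_inj, cmp_apply_inj, map_zsmul, map_zsmul, cmp_inj, ← hab,
      GrMod.tw_inj, hab, map_zsmul, map_neg, map_zsmul]
    have hp : par (g + m) = par g + par m := by simp [par]
    rw [hp]
    rw [par_sub_deg1, add_right_comm] at h
    rw [eq_neg_of_add_eq_zero_right h]
    have e : ∀ s t : ZMod 2, ksgn s * ksgn (1 * (s + t)) = ksgn t ∧
        ksgn t * ksgn (s + 1) = - (ksgn s * ksgn t) := by decide
    rw [smul_neg, neg_neg, smul_add, smul_smul, smul_smul, smul_smul, (e _ _).1, (e _ _).2,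
      neg_smul, sub_eq_add_neg]

variable (C) in
/-- A chosen cohomological unit. -/
def unitRep (X : C.Obj) : (C.Hom X X).V 0 := (C.unital X).choose

theorem unitRep_spec (X : C.Obj) : C.IsCohUnit X (C.unitRep X) := (C.unital X).choose_spec

variable (C) in
/-- The identity class of an object. -/
def hid (X : C.Obj) : C.H X X := C.cls X X (hom₀ (C.unitRep X) (unitRep_spec X).1)

theorem hid_hcmp {X Y : C.Obj} (x : C.H X Y) : C.hcmp X Y Y (C.hid Y) x = x := by
  induction x using H_ind with
  | h0 => simp
  | hadd x x' h h' => simp only [map_add, h, h']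
  | hc g a ha =>
    obtain ⟨b, hb⟩ := (unitRep_spec Y).2.2 X g a ha
    rw [hid, hcmp_cls, ← sub_eq_zero, ← map_sub, cls_eq_zero]
    refine ⟨(C.Hom X Y).inj _ b, ?_⟩
    change _ = C.cmp X Y Y ((C.Hom Y Y).inj 0 (C.unitRep Y)) ((C.Hom X Y).inj g a) -
      (C.Hom X Y).inj g a
    rw [cmp_inj_inj, hb, d_inj]; abel

theorem hcmp_hid {X Y : C.Obj} (x : C.H X Y) : C.hcmp X X Y x (C.hid X) = x := by
  induction x using H_ind with
  | h0 => simp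
  | hadd x x' h h' => simp only [map_add, LinearMap.add_apply, h, h']
  | hc g a ha =>
    obtain ⟨b, hb⟩ := (unitRep_spec X).2.1 Y g a ha
    rw [hid, hcmp_cls, ← sub_eq_zero, ← map_sub, cls_eq_zero]
    refine ⟨(C.Hom X Y).inj _ b, ?_⟩
    change _ = C.cmp X X Y ((C.Hom X Y).inj g a) ((C.Hom X X).inj 0 (C.unitRep X)) -
      (C.Hom X Y).inj g a
    rw [cmp_inj_inj, hb, d_inj]
    have e : ksgn (par (0 : G)) = 1 := by simp [par, ksgn]
    rw [e]; simp

/-- The unital algebra `H^*(hom(X, X))`, with product `b a = b ∘ a`. -/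
instance instRingH (X : C.Obj) : Ring (C.H X X) where
  __ := (inferInstance : AddCommGroup (C.H X X))
  mul y x := C.hcmp X X X y x
  one := C.hid X
  left_distrib y x x' := map_add (C.hcmp X X X y) x x'
  right_distrib y y' x := by
    change C.hcmp X X X (y + y') x = C.hcmp X X X y x + C.hcmp X X X y' x
    rw [map_add]; rfl
  zero_mul x := by change C.hcmp X X X 0 x = 0; simp
  mul_zero x := by change C.hcmp X X X x 0 = 0; simp
  mul_assoc z y x := (hcmp_assoc z y x).symm
  one_mul := hid_hcmp
  mul_one := hcmp_hid

end AInfCat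

/-- A copairing `c ∈ A ⊗ A` on a unital algebra `A` is entirely degenerate if every element of the
image of `c^* : A^∨ → A`, `φ ↦ (φ ⊗ id)(c)`, is nilpotent. -/
def EntirelyDegenerate {A : Type w} [Ring A] [Module K A] (c : A ⊗[K] A) : Prop :=
  ∀ φ : Module.Dual K A, IsNilpotent (TensorProduct.lid K A (LinearMap.rTensor A φ c))


/-! ### Full subcategories -/

/-- A path in a full subquiver, regarded as a path in the ambient quiver. -/
def Pth.emb {O' : Type u} {H' : O' → O' → GrMod.{v, w} K G} {S : Set O'} :
    ∀ {X Y : S}, Pth (fun X Y : S => H' X Y) X Y → Pth H' (X : O') (Y : O')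
  | _, _, nil X => nil (X : O')
  | _, _, cons g a p => cons g a (emb p)

namespace Pth

variable {O' : Type u} {H' : O' → O' → GrMod.{v, w} K G} {S : Set O'}

theorem emb_append {X Y Z : S} (p : Pth (fun X Y : S => H' X Y) X Y)
    (q : Pth (fun X Y : S => H' X Y) Y Z) : (p.append q).emb = p.emb.append q.emb := by
  induction p with
  | nil => rfl
  | cons g a p ih => simp [emb, ih]

theorem rdeg_emb {X Y : S} (p : Pth (fun X Y : S => H' X Y) X Y) : p.emb.rdeg = p.rdeg := by
  induction p with
  | nil => rfl
  | cons g a p ih => simp [emb, rdeg, ih]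

theorem splitSum_emb {W : Type w₁} [AddCommGroup W] {X Y : S}
    (p : Pth (fun X Y : S => H' X Y) X Y) (F : ∀ Z, Pth H' X Z → Pth H' Z Y → W) :
    splitSum p.emb F = splitSum p fun Z l r => F Z l.emb r.emb := by
  induction p with
  | nil => rfl
  | cons g a p ih => simp only [emb, splitSum, ih]

theorem PLin.emb {W : Type w₁} [AddCommGroup W] [Module K W] {X Y : S}
    {F : Pth H' (X : O') (Y : O') → W} (h : PLin F) :
    PLin fun p : Pth (fun X Y : S => H' X Y) X Y => F p.emb := fun A B s t g => by
  obtain ⟨L, hL⟩ := h A B s.emb t.emb g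
  exact ⟨L, fun a => by
    change F (s.append (cons g a t)).emb = _
    rw [emb_append]; exact hL a⟩

end Pth

/-- The full A∞ subcategory on a set of objects. -/
def AInfCat.full (P : AInfCat.{u, v, w} K G) (S : Set P.Obj) : AInfCat.{u, v, w} K G where
  Obj := S
  Hom X Y := P.Hom X Y
  μ p := P.μ p.emb
  μ_nil X := P.μ_nil X
  μ_lin := P.μ_lin.emb
  μ_deg p := by
    have h := P.μ_deg p.emb
    rwa [rdeg_emb] at h
  rel {X Y} p := by
    rw [← P.rel p.emb]
    unfold barSum
    rw [splitSum_emb]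
    congr; funext Z l r
    rw [splitSum_emb]
    congr; funext Z' l₁ l₂
    rw [rdeg_emb, rdeg_emb]
    exact congrArg (fun t => ksgn (par l₁.rdeg) • P.μ t) (emb_append _ _)
  unital X := by
    obtain ⟨e, h1, h2, h3⟩ := P.unital X
    exact ⟨e, h1, fun Y => h2 Y, fun Y => h3 Y⟩

/-! ### A∞ bimodules -/

/-- The data of an A∞ bimodule over `C`: a graded space `M(X, Y)`, contravariant in `X` and
covariant in `Y`, with structure maps `M(X', Y) → M(X, Y')` for strings `X → … → X'` and
`Y → … → Y'`. The structure map for two empty strings is the differential. -/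
structure PreBimod (C : AInfCat.{u, v, w} K G) where
  M : C.Obj → C.Obj → GrMod.{v, w₁} K G
  act : ∀ X X' Y Y' : C.Obj, Pth C.Hom X X' → Pth C.Hom Y Y' →
    ((M X' Y).Tot →ₗ[K] (M X Y').Tot)

namespace PreBimod

variable {C : AInfCat.{u, v, w} K G}

/-- Families of maps `φ(p; -; q) : M(X', Y) → N(X, Y')`. -/
abbrev Cochain (M : PreBimod.{u, v, w, w₁} C) (N : PreBimod.{u, v, w, w₂} C) :
    Type (max u w w₁ w₂) :=
  ∀ X X' Y Y' : C.Obj, Pth C.Hom X X' → Pth C.Hom Y Y' →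
    ((M.M X' Y).Tot →ₗ[K] (N.M X Y').Tot)

/-- The bimodule pre-morphisms of degree `d`: multilinear families, where `φ(p; -; q)` has degree
`d + ‖p‖ + ‖q‖`. -/
def HomSub (M : PreBimod.{u, v, w, w₁} C) (N : PreBimod.{u, v, w, w₂} C) (d : G) :
    Submodule K (Cochain M N) where
  carrier := {φ | (∀ X X' Y Y' q, PLin fun p => φ X X' Y Y' p q) ∧
    (∀ X X' Y Y' p, PLin fun q => φ X X' Y Y' p q) ∧
    ∀ X X' Y Y' p q, φ X X' Y Y' p q ∈ HDeg _ _ (d + p.rdeg + q.rdeg)}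
  add_mem' {φ φ'} h h' := by
    refine ⟨fun X X' Y Y' q => ?_, fun X X' Y Y' p => ?_, fun X X' Y Y' p q => ?_⟩
    · exact PLin.add (h.1 X X' Y Y' q) (h'.1 X X' Y Y' q)
    · exact PLin.add (h.2.1 X X' Y Y' p) (h'.2.1 X X' Y Y' p)
    · exact Submodule.add_mem _ (h.2.2 X X' Y Y' p q) (h'.2.2 X X' Y Y' p q)
  zero_mem' := by
    refine ⟨fun X X' Y Y' q => ?_, fun X X' Y Y' p => ?_, fun X X' Y Y' p q => ?_⟩
    · exact PLin.zero
    · exact PLin.zero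
    · exact Submodule.zero_mem _
  smul_mem' c {φ} h := by
    refine ⟨fun X X' Y Y' q => ?_, fun X X' Y Y' p => ?_, fun X X' Y Y' p q => ?_⟩
    · exact PLin.smul (h.1 X X' Y Y' q) c
    · exact PLin.smul (h.2.1 X X' Y Y' p) c
    · exact Submodule.smul_mem _ c (h.2.2 X X' Y Y' p q)

/-- The composition
`(φ ∘ ψ)(p; m; q) = ∑ (-1)^{|ψ| ‖p₁‖} φ(p₁; ψ(p₂; m; q₁); q₂)`, where `e` is the parity of `ψ`. -/
def comp {M : PreBimod.{u, v, w, w₁} C} {N : PreBimod.{u, v, w, w₂} C}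
    {Q : PreBimod.{u, v, w, w₃} C} (e : ZMod 2) (φ : Cochain N Q) (ψ : Cochain M N) :
    Cochain M Q := fun X X' Y Y' p q =>
  splitSum p fun X₁ p₁ p₂ => splitSum q fun Y₁ q₁ q₂ =>
    ksgn (e * par p₁.rdeg) • (φ X X₁ Y₁ Y' p₁ q₂ ∘ₗ ψ X₁ X' Y Y₁ p₂ q₁)

/-- Precomposition of `φ` with the bar differential of `M`. -/
def preB {M : PreBimod.{u, v, w, w₁} C} {N : PreBimod.{u, v, w, w₂} C} (φ : Cochain M N) :
    Cochain M N := fun X X' Y Y' p q =>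
  barSum C.μ (fun p' => φ X X' Y Y' p' q) p + comp 1 φ M.act X X' Y Y' p q +
    ksgn (par p.rdeg) • (barSum C.μ (fun q' => φ X X' Y Y' p q') q ∘ₗ (M.M X' Y).tw 1)

/-- The A∞ bimodule axioms. -/
structure IsBimod (M : PreBimod.{u, v, w, w₁} C) : Prop where
  mem : M.act ∈ HomSub M M (deg1 G)
  rel : preB (M := M) (N := M) M.act = 0

/-- The differential on pre-morphisms of degree `d`. -/
def δ {M : PreBimod.{u, v, w, w₁} C} {N : PreBimod.{u, v, w, w₂} C} (d : G) (φ : Cochain M N) :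
    Cochain M N :=
  comp (par d) N.act φ - ksgn (par d) • preB φ

/-- Closed bimodule morphisms of degree `d`. -/
def IsClosedMor {M : PreBimod.{u, v, w, w₁} C} {N : PreBimod.{u, v, w, w₂} C} (d : G)
    (φ : Cochain M N) : Prop := φ ∈ HomSub M N d ∧ δ d φ = 0

/-- Two pre-morphisms of degree `d` differ by an exact one. -/
def Homotopic {M : PreBimod.{u, v, w, w₁} C} {N : PreBimod.{u, v, w, w₂} C} (d : G)
    (φ φ' : Cochain M N) : Prop :=
  ∃ η ∈ HomSub M N (d - deg1 G), φ - φ' = δ (d - deg1 G) η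

/-- The identity morphism. -/
def idMor (M : PreBimod.{u, v, w, w₁} C) : Cochain M M
  | _, _, _, _, nil _, nil _ => LinearMap.id
  | _, _, _, _, nil _, cons _ _ _ => 0
  | _, _, _, _, cons _ _ _, _ => 0

/-- `φ` (of degree `d`) and `ψ` (of degree `-d`) are mutually inverse in cohomology. -/
def IsHomotopyInverse {M : PreBimod.{u, v, w, w₁} C} {N : PreBimod.{u, v, w, w₂} C} (d : G)
    (φ : Cochain M N) (ψ : Cochain N M) : Prop :=
  Homotopic 0 (comp (par d) ψ φ) (idMor M) ∧ Homotopic 0 (comp (par (-d)) φ ψ) (idMor N)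

section Mem

variable {M : PreBimod.{u, v, w, w₁} C} {N : PreBimod.{u, v, w, w₂} C}
  {Q : PreBimod.{u, v, w, w₃} C}

theorem comp_mem {a b c : G} (e : ZMod 2) {φ : Cochain N Q} {ψ : Cochain M N}
    (hφ : φ ∈ HomSub N Q a) (hψ : ψ ∈ HomSub M N b) (hc : c = a + b) :
    comp e φ ψ ∈ HomSub M Q c := by
  refine ⟨fun X X' Y Y' q => ?_, fun X X' Y Y' p => ?_, fun X X' Y Y' p q => ?_⟩
  · refine PLin.splitSum (fun X₁ p₂ => ?_) fun X₁ p₁ => ?_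
    · intro A B s t g
      refine splitSum_lin (K := K) q _ fun Y₁ q₁ q₂ => ?_
      exact (PLin.dep (E := fun k p₁ => ksgn (e * par k) • (φ X X₁ Y₁ Y' p₁ q₂ ∘ₗ
        ψ X₁ X' Y Y₁ p₂ q₁)) fun k => ((hφ.1 X X₁ Y₁ Y' q₂).map
          (LinearMap.lcomp K _ (ψ X₁ X' Y Y₁ p₂ q₁))).zsmul _) A B s t g
    · intro A B s t g
      refine splitSum_lin (K := K) q _ fun Y₁ q₁ q₂ => ?_
      exact (((hψ.1 X₁ X' Y Y₁ q₁).map (LinearMap.llcomp K _ _ _ (φ X X₁ Y₁ Y' p₁ q₂))).zsmul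
        (ksgn (e * par p₁.rdeg))) A B s t g
  · intro A B s t g
    refine splitSum_lin (K := K) p _ fun X₁ p₁ p₂ => ?_
    refine PLin.splitSum (fun Y₁ q₂ => ?_) (fun Y₁ q₁ => ?_) A B s t g
    · exact ((hψ.2.1 X₁ X' Y Y₁ p₂).map (LinearMap.llcomp K _ _ _ (φ X X₁ Y₁ Y' p₁ q₂))).zsmul _
    · exact ((hφ.2.1 X X₁ Y₁ Y' p₁).map (LinearMap.lcomp K _ (ψ X₁ X' Y Y₁ p₂ q₁))).zsmul _
  · refine splitSum_mem _ _ _ fun X₁ p₁ p₂ hp => splitSum_mem _ _ _ fun Y₁ q₁ q₂ hq => ?_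
    refine zsmul_mem (HDeg.comp_mem (hφ.2.2 _ _ _ _ p₁ q₂) (hψ.2.2 _ _ _ _ p₂ q₁) ?_) _
    rw [hc, ← hp, ← hq, rdeg_append, rdeg_append]; abel

theorem preB_mem {d d' : G} {φ : Cochain M N} (hM : M.act ∈ HomSub M M (deg1 G))
    (hφ : φ ∈ HomSub M N d) (hd : d' = d + deg1 G) : preB φ ∈ HomSub M N d' := by
  have hc := comp_mem (c := d') 1 hφ hM hd
  refine ⟨fun X X' Y Y' q => ?_, fun X X' Y Y' p => ?_, fun X X' Y Y' p q => ?_⟩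
  · refine ((PLin.barSum C.μ_lin (hφ.1 X X' Y Y' q)).add (hc.1 X X' Y Y' q)).add ?_
    refine PLin.dep (E := fun k p => ksgn (par k) •
      (barSum C.μ (fun q' => φ X X' Y Y' p q') q ∘ₗ (M.M X' Y).tw 1)) fun k => ?_
    refine PLin.zsmul (PLin.map (F := fun p => barSum C.μ (fun q' => φ X X' Y Y' p q') q) ?_
      (LinearMap.lcomp K _ ((M.M X' Y).tw 1))) _
    intro A B s t g
    refine splitSum_lin (K := K) q _ fun _ q' q₃ => splitSum_lin (K := K) q' _ fun _ q₁ q₂ => ?_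
    exact ((hφ.1 X X' Y Y' _).zsmul _) A B s t g
  · refine (PLin.add (F := fun q => barSum C.μ (fun p' => φ X X' Y Y' p' q) p) ?_
      (hc.2.1 X X' Y Y' p)).add ?_
    · intro A B s t g
      refine splitSum_lin (K := K) p _ fun _ q' q₃ => splitSum_lin (K := K) q' _ fun _ q₁ q₂ => ?_
      exact ((hφ.2.1 X X' Y Y' _).zsmul _) A B s t g
    · exact ((PLin.barSum C.μ_lin (hφ.2.1 X X' Y Y' p)).map
        (LinearMap.lcomp K _ ((M.M X' Y).tw 1))).zsmul _
  · refine Submodule.add_mem _ (Submodule.add_mem _ ?_ (hc.2.2 X X' Y Y' p q)) ?_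
    · refine barSum_mem _ _ _ _ fun p' hp' => ?_
      have h := hφ.2.2 X X' Y Y' p' q
      have e : d + p'.rdeg + q.rdeg = d' + p.rdeg + q.rdeg := by rw [hp', hd]; abel
      rwa [e] at h
    · refine zsmul_mem (HDeg.comp_mem (j := d' + p.rdeg + q.rdeg) (k := 0)
        (barSum_mem _ _ _ _ fun q' hq' => ?_) (HDeg.tw_mem _ _) (by abel)) _
      have h := hφ.2.2 X X' Y Y' p q'
      have e : d + p.rdeg + q'.rdeg = d' + p.rdeg + q.rdeg := by rw [hq', hd]; abel
      rwa [e] at h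

theorem δ_mem {d d' : G} {φ : Cochain M N} (hM : M.act ∈ HomSub M M (deg1 G))
    (hN : N.act ∈ HomSub N N (deg1 G)) (hφ : φ ∈ HomSub M N d) (hd : d' = d + deg1 G) :
    δ d φ ∈ HomSub M N d' :=
  Submodule.sub_mem _ (comp_mem _ hN hφ (by rw [hd]; abel)) (zsmul_mem (preB_mem hM hφ hd) _)

theorem comp_add (e : ZMod 2) (φ : Cochain N Q) (ψ ψ' : Cochain M N) :
    comp e φ (ψ + ψ') = comp e φ ψ + comp e φ ψ' := by
  funext X X' Y Y' p q
  simp only [comp, Pi.add_apply, LinearMap.comp_add, smul_add, splitSum_add]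

theorem add_comp (e : ZMod 2) (φ φ' : Cochain N Q) (ψ : Cochain M N) :
    comp e (φ + φ') ψ = comp e φ ψ + comp e φ' ψ := by
  funext X X' Y Y' p q
  simp only [comp, Pi.add_apply, LinearMap.add_comp, smul_add, splitSum_add]

theorem splitSum_smul {W : Type w₁} [AddCommGroup W] [Module K W] {X Y : C.Obj}
    (c : K) (p : Pth C.Hom X Y) (F : ∀ Z, Pth C.Hom X Z → Pth C.Hom Z Y → W) :
    splitSum p (fun Z l r => c • F Z l r) = c • splitSum p F :=
  splitSum_map (DistribSMul.toAddMonoidHom W c) p F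

theorem barSum_smul {W : Type w₁} [AddCommGroup W] [Module K W] {X Y : C.Obj}
    (c : K) (z : ∀ {X Y : C.Obj}, Pth C.Hom X Y → (C.Hom X Y).Tot) (p : Pth C.Hom X Y)
    (F : Pth C.Hom X Y → W) :
    barSum z (fun q => c • F q) p = c • barSum z F p :=
  barSum_map (DistribSMul.toAddMonoidHom W c) z F p

theorem comp_smul (e : ZMod 2) (c : K) (φ : Cochain N Q) (ψ : Cochain M N) :
    comp e φ (c • ψ) = c • comp e φ ψ := by
  funext X X' Y Y' p q
  simp only [comp, Pi.smul_apply, LinearMap.comp_smul, ← splitSum_smul, smul_comm c]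

theorem smul_comp (e : ZMod 2) (c : K) (φ : Cochain N Q) (ψ : Cochain M N) :
    comp e (c • φ) ψ = c • comp e φ ψ := by
  funext X X' Y Y' p q
  simp only [comp, Pi.smul_apply, LinearMap.smul_comp, ← splitSum_smul, smul_comm c]

theorem preB_add (φ φ' : Cochain M N) : preB (φ + φ') = preB φ + preB φ' := by
  funext X X' Y Y' p q
  simp only [preB, add_comp, Pi.add_apply, barSum_add, LinearMap.add_comp, smul_add]
  abel

theorem preB_smul (c : K) (φ : Cochain M N) : preB (c • φ) = c • preB φ := by
  funext X X' Y Y' p q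
  simp only [preB, smul_comp, Pi.smul_apply, barSum_smul, LinearMap.smul_comp, smul_add,
    smul_comm c]

/-- `δ` as a linear map. -/
def δLin (M : PreBimod.{u, v, w, w₁} C) (N : PreBimod.{u, v, w, w₂} C) (d : G) :
    Cochain M N →ₗ[K] Cochain M N where
  toFun := δ d
  map_add' φ φ' := by simp only [δ, comp_add, preB_add, smul_add]; abel
  map_smul' c φ := by
    simp only [δ, comp_smul, preB_smul, smul_sub, RingHom.id_apply, smul_comm c]

end Mem

end PreBimod

/-! ### The diagonal bimodule and Yoneda bimodules -/

theorem exists_lin_of_inj {V : Type w₁} [AddCommGroup V] [Module K V] {A : GrMod.{v, w} K G}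
    {W : Type w₂} [AddCommGroup W] [Module K W] (F : V → (A.Tot →ₗ[K] W))
    (h : ∀ k b, ∃ L : V →ₗ[K] W, ∀ a, F a (A.inj k b) = L a) :
    ∃ L : V →ₗ[K] (A.Tot →ₗ[K] W), ∀ a, F a = L a := by
  refine ⟨{ toFun := F, map_add' := fun a a' => ?_, map_smul' := fun c a => ?_ }, fun a => rfl⟩
  · refine DirectSum.linearMap_ext K fun k => LinearMap.ext fun b => ?_
    obtain ⟨L, hL⟩ := h k b
    change F (a + a') (A.inj k b) = F a (A.inj k b) + F a' (A.inj k b)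
    simp only [hL, map_add]
  · refine DirectSum.linearMap_ext K fun k => LinearMap.ext fun b => ?_
    obtain ⟨L, hL⟩ := h k b
    change F (c • a) (A.inj k b) = c • F a (A.inj k b)
    simp only [hL, map_smul]

theorem Pth.PLin.of_cons {H : O → O → GrMod.{v, w} K G} {W : Type w₁} [AddCommGroup W] [Module K W]
    {X Y : O} {F : Pth H X Y → W}
    (h : ∀ (A : O) (g : G) (a : (H X A).V g) (p : Pth H A Y), F (cons g a p) = 0) : PLin F := by
  intro A B s t g
  refine ⟨0, fun a => ?_⟩
  cases s with
  | nil => exact h _ _ _ _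
  | cons g' b s => exact h _ _ _ _

namespace PreBimod

variable {C : AInfCat.{u, v, w} K G}

/-- The structure maps `x ↦ -(-1)^{‖p‖} μ(p, x, q)` of the diagonal bimodule. -/
def diagAct (C : AInfCat.{u, v, w} K G) {X X' Y Y' : C.Obj} (p : Pth C.Hom X X')
    (q : Pth C.Hom Y Y') : (C.Hom X' Y).Tot →ₗ[K] (C.Hom X Y').Tot :=
  (-ksgn (par p.rdeg)) • C.μ_lin.toTot p q

/-- The diagonal bimodule `C_Δ(X, Y) = hom(X, Y)`. -/
def diag (C : AInfCat.{u, v, w} K G) : PreBimod.{u, v, w, w} C where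
  M X Y := C.Hom X Y
  act _ _ _ _ p q := diagAct C p q

/-- The part of the structure maps of `hom(-, B) ⊗ hom(A, -)` acting on the first factor. -/
def yonL (C : AInfCat.{u, v, w} K G) (A B : C.Obj) {X X' : C.Obj} :
    ∀ {Y Y' : C.Obj}, Pth C.Hom X X' → Pth C.Hom Y Y' →
    ((tens (C.Hom X' B) (C.Hom A Y)).Tot →ₗ[K] (tens (C.Hom X B) (C.Hom A Y')).Tot)
  | _, _, p, nil _ => tmap (diagAct C p (nil B)) LinearMap.id
  | _, _, _, cons _ _ _ => 0

/-- The part of the structure maps of `hom(-, B) ⊗ hom(A, -)` acting on the second factor. -/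
def yonR (C : AInfCat.{u, v, w} K G) (A B : C.Obj) {Y Y' : C.Obj} :
    ∀ {X X' : C.Obj}, Pth C.Hom X X' → Pth C.Hom Y Y' →
    ((tens (C.Hom X' B) (C.Hom A Y)).Tot →ₗ[K] (tens (C.Hom X B) (C.Hom A Y')).Tot)
  | X, _, nil _, q => tmap ((C.Hom X B).tw 1) (diagAct C (nil A) q)
  | _, _, cons _ _ _, _ => 0

/-- The Yoneda bimodule `Y_{A,B}(X, Y) = hom(X, B) ⊗ hom(A, Y)`. -/
def yon (C : AInfCat.{u, v, w} K G) (A B : C.Obj) : PreBimod.{u, v, w, w} C where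
  M X Y := tens (C.Hom X B) (C.Hom A Y)
  act _ _ _ _ p q := yonL C A B p q + yonR C A B p q

theorem diagAct_lin_left {X X' Y Y' : C.Obj} (q : Pth C.Hom Y Y') :
    PLin fun p : Pth C.Hom X X' => diagAct C p q := by
  refine PLin.dep (E := fun k p => (-ksgn (par k)) • C.μ_lin.toTot p q) fun k => PLin.zsmul ?_ _
  intro A B s t g
  refine exists_lin_of_inj _ fun k b => ⟨C.μ_lin.toLin s (t.append (cons k b q)) g, fun a => ?_⟩
  rw [PLin.toTot_inj, append_assoc]; rfl

theorem diagAct_lin_right {X X' Y Y' : C.Obj} (p : Pth C.Hom X X') :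
    PLin fun q : Pth C.Hom Y Y' => diagAct C p q := by
  refine PLin.zsmul (F := fun q : Pth C.Hom Y Y' => C.μ_lin.toTot p q) ?_ _
  intro A B s t g
  refine exists_lin_of_inj _ fun k b => ⟨C.μ_lin.toLin (p.append (cons k b s)) t g, fun a => ?_⟩
  rw [PLin.toTot_inj]
  change _ = C.μ ((p.append (cons k b s)).append (cons g a t))
  rw [append_assoc]; rfl

theorem diagAct_deg {X X' Y Y' : C.Obj} (p : Pth C.Hom X X') (q : Pth C.Hom Y Y') {k : G}
    (hk : k = deg1 G + p.rdeg + q.rdeg) :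
    diagAct C p q ∈ HDeg (C.Hom X' Y) (C.Hom X Y') k := by
  refine zsmul_mem (S := Submodule K _) ?_ _
  intro g a
  have h := C.μ_deg (p.append (cons g a q))
  have e : (p.append (cons g a q)).rdeg + deg1 G + deg1 G = g + k := by
    rw [hk, rdeg_append, rdeg]; abel
  rw [e] at h
  rwa [PLin.toTot_inj]

theorem diag_mem : (diag C).act ∈ HomSub (diag C) (diag C) (deg1 G) :=
  ⟨fun _ _ _ _ q => diagAct_lin_left q, fun _ _ _ _ p => diagAct_lin_right p,
    fun _ _ _ _ p q => diagAct_deg p q rfl⟩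

theorem yon_mem (A B : C.Obj) :
    (yon C A B).act ∈ HomSub (yon C A B) (yon C A B) (deg1 G) := by
  refine ⟨fun X X' Y Y' q => PLin.add ?_ ?_, fun X X' Y Y' p => PLin.add ?_ ?_,
    fun X X' Y Y' p q => Submodule.add_mem _ ?_ ?_⟩
  · cases q with
    | nil => exact (diagAct_lin_left (nil B)).map ((tmapLin _ _ _ _).flip LinearMap.id)
    | cons => exact PLin.zero
  · exact PLin.of_cons fun _ _ _ _ => rfl
  · refine PLin.of_cons fun _ _ _ _ => rfl
  · cases p with
    | nil => exact (diagAct_lin_right (nil A)).map (tmapLin _ _ _ _ ((C.Hom X B).tw 1))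
    | cons => exact PLin.zero
  · cases q with
    | nil =>
      exact tmap_mem (diagAct_deg p (nil B) rfl) (HDeg.id_mem _) (by simp [rdeg])
    | cons => exact Submodule.zero_mem _
  · cases p with
    | nil =>
      exact tmap_mem (HDeg.tw_mem _ _) (diagAct_deg (nil A) q rfl) (by simp [rdeg])
    | cons => exact Submodule.zero_mem _

/-! ### The inverse dualizing bimodule -/

/-- The map `v ⊗ w ↦ (-1)^{‖l‖ |v|} μ_Δ(p; v; l) ⊗ w`. -/
def mapL (A : C.Obj) {B B' X X₁ : C.Obj} (p : Pth C.Hom X X₁) (l : Pth C.Hom B B') (Y : C.Obj) :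
    ((yon C A B).M X₁ Y).Tot →ₗ[K] ((yon C A B').M X Y).Tot :=
  tmap (diagAct C p l ∘ₗ (C.Hom X₁ B).tw (par l.rdeg)) LinearMap.id

/-- The map `v ⊗ w ↦ (-1)^{(‖r‖ + 1) |v|} v ⊗ μ_Δ(r; w; q)`. -/
def mapR {A A' : C.Obj} (B X : C.Obj) {Y₁ Y : C.Obj} (r : Pth C.Hom A' A) (q : Pth C.Hom Y₁ Y) :
    ((yon C A B).M X Y₁).Tot →ₗ[K] ((yon C A' B).M X Y).Tot :=
  tmap ((C.Hom X B).tw (par r.rdeg + 1)) (diagAct C r q)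

/-- The action of a string `l : B → … → B'` on a pre-morphism `C_Δ → Y_{A,B}` of degree `d`,
through the factor `hom(-, B)`. -/
def actL (A : C.Obj) {B B' : C.Obj} (d : G) (l : Pth C.Hom B B')
    (φ : Cochain (diag C) (yon C A B)) : Cochain (diag C) (yon C A B') := fun X X' Y Y' p q =>
  splitSum p fun X₁ p₁ p₂ =>
    ksgn (par l.rdeg * (par p₁.rdeg + par d) + par d * par p₁.rdeg) •
      (mapL A p₁ l Y' ∘ₗ φ X₁ X' Y Y' p₂ q)

/-- The action of a string `r : A' → … → A` on a pre-morphism `C_Δ → Y_{A,B}`, through the factor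
`hom(A, -)`. -/
def actR {A A' : C.Obj} (B : C.Obj) (r : Pth C.Hom A' A)
    (φ : Cochain (diag C) (yon C A B)) : Cochain (diag C) (yon C A' B) := fun X X' Y Y' p q =>
  splitSum q fun _ q₁ q₂ =>
    mapR B X r q₂ ∘ₗ φ X X' Y _ p q₁

theorem actL_mem (A : C.Obj) {B B' : C.Obj} {d d' : G} (l : Pth C.Hom B B')
    {φ : Cochain (diag C) (yon C A B)} (hφ : φ ∈ HomSub (diag C) (yon C A B) d)
    (hd : d' = d + l.rdeg + deg1 G) : actL A d l φ ∈ HomSub (diag C) (yon C A B') d' := by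
  refine ⟨fun X X' Y Y' q => ?_, fun X X' Y Y' p => ?_, fun X X' Y Y' p q => ?_⟩
  · refine PLin.splitSum (fun X₁ p₂ => ?_) fun X₁ p₁ => ?_
    · refine PLin.dep (E := fun k p₁ =>
        ksgn (par l.rdeg * (par k + par d) + par d * par k) •
          (mapL A p₁ l Y' ∘ₗ φ X₁ X' Y Y' p₂ q)) fun k => PLin.zsmul ?_ _
      exact (((diagAct_lin_left l).map (LinearMap.lcomp K _ ((C.Hom X₁ B).tw (par l.rdeg)))).map
        ((tmapLin _ _ _ _).flip LinearMap.id)).map (LinearMap.lcomp K _ (φ X₁ X' Y Y' p₂ q))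
    · exact ((hφ.1 X₁ X' Y Y' q).map (LinearMap.llcomp K _ _ _
        (mapL A p₁ l Y'))).zsmul _
  · intro A₁ B₁ s t g
    refine splitSum_lin (K := K) p _ fun X₁ p₁ p₂ => ?_
    exact (((hφ.2.1 X₁ X' Y Y' p₂).map (LinearMap.llcomp K _ _ _
        (mapL A p₁ l Y'))).zsmul
        (ksgn (par l.rdeg * (par p₁.rdeg + par d) + par d * par p₁.rdeg))) A₁ B₁ s t g
  · refine splitSum_mem _ _ _ fun X₁ p₁ p₂ hp => zsmul_mem ?_ _
    refine HDeg.comp_mem (tmap_mem (HDeg.comp_mem (diagAct_deg p₁ l rfl) (HDeg.tw_mem _ _) rfl)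
      (HDeg.id_mem _) rfl) (hφ.2.2 X₁ X' Y Y' p₂ q) ?_
    rw [hd, ← hp, rdeg_append]; abel

theorem actR_mem {A A' : C.Obj} (B : C.Obj) {d d' : G} (r : Pth C.Hom A' A)
    {φ : Cochain (diag C) (yon C A B)} (hφ : φ ∈ HomSub (diag C) (yon C A B) d)
    (hd : d' = d + r.rdeg + deg1 G) : actR B r φ ∈ HomSub (diag C) (yon C A' B) d' := by
  refine ⟨fun X X' Y Y' q => ?_, fun X X' Y Y' p => ?_, fun X X' Y Y' p q => ?_⟩
  · intro A₁ B₁ s t g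
    refine splitSum_lin (K := K) q _ fun Y₁ q₁ q₂ => ?_
    exact ((hφ.1 X X' Y Y₁ q₁).map (LinearMap.llcomp K _ _ _
      (mapR B X r q₂))) A₁ B₁ s t g
  · refine PLin.splitSum (fun Y₁ q₂ => ?_) fun Y₁ q₁ => ?_
    · exact (hφ.2.1 X X' Y Y₁ p).map (LinearMap.llcomp K _ _ _
        (mapR B X r q₂))
    · exact ((diagAct_lin_right r).map (tmapLin _ _ _ _ ((C.Hom X B).tw (par r.rdeg + 1)))).map
        (LinearMap.lcomp K _ (φ X X' Y Y₁ p q₁))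
  · refine splitSum_mem _ _ _ fun Y₁ q₁ q₂ hq => ?_
    refine HDeg.comp_mem (tmap_mem (HDeg.tw_mem _ _) (diagAct_deg r q₂ rfl) rfl)
      (hφ.2.2 X X' Y Y₁ p q₁) ?_
    rw [hd, ← hq, rdeg_append]; abel

/-- `actL` as a linear map. -/
def actLLin (A : C.Obj) {B B' : C.Obj} (d : G) (l : Pth C.Hom B B') :
    Cochain (diag C) (yon C A B) →ₗ[K] Cochain (diag C) (yon C A B') where
  toFun := actL A d l
  map_add' φ φ' := by
    funext X X' Y Y' p q
    simp only [actL, Pi.add_apply, LinearMap.comp_add, smul_add, splitSum_add]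
  map_smul' c φ := by
    funext X X' Y Y' p q
    simp only [actL, Pi.smul_apply, LinearMap.comp_smul, ← splitSum_smul, smul_comm c,
      RingHom.id_apply]

/-- `actR` as a linear map. -/
def actRLin {A A' : C.Obj} (B : C.Obj) (r : Pth C.Hom A' A) :
    Cochain (diag C) (yon C A B) →ₗ[K] Cochain (diag C) (yon C A' B) where
  toFun := actR B r
  map_add' φ φ' := by
    funext X X' Y Y' p q
    simp only [actR, Pi.add_apply, LinearMap.comp_add, splitSum_add]
  map_smul' c φ := by
    funext X X' Y Y' p q
    simp only [actR, Pi.smul_apply, LinearMap.comp_smul, ← splitSum_smul, RingHom.id_apply]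

/-- The structure maps of the inverse dualizing bimodule on pre-morphisms of degree `d`: the
differential for empty strings, the actions through one of the two factors of `Y_{A,B}` if exactly
one of the strings is empty, and zero otherwise. -/
def dualAct (d : G) : ∀ {A A' B B' : C.Obj}, Pth C.Hom A' A → Pth C.Hom B B' →
    (Cochain (diag C) (yon C A B) →ₗ[K] Cochain (diag C) (yon C A' B'))
  | _, _, _, _, nil A, nil B => δLin (diag C) (yon C A B) d
  | _, _, _, _, nil A, cons g a l => actLLin A d (cons g a l)
  | _, _, B, _, cons g a r, nil _ => actRLin B (cons g a r)
  | _, _, _, _, cons _ _ _, cons _ _ _ => 0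

theorem dualAct_mem {d : G} {A A' B B' : C.Obj} (r : Pth C.Hom A' A) (l : Pth C.Hom B B')
    {φ : Cochain (diag C) (yon C A B)} (hφ : φ ∈ HomSub (diag C) (yon C A B) d) :
    dualAct d r l φ ∈ HomSub (diag C) (yon C A' B') (d + r.rdeg + l.rdeg + deg1 G) := by
  cases r with
  | nil =>
    cases l with
    | nil => exact δ_mem diag_mem (yon_mem _ _) hφ (by simp [rdeg])
    | cons g a l => exact actL_mem _ _ hφ (by simp [rdeg])
  | cons g a r =>
    cases l with
    | nil => exact actR_mem _ _ hφ (by simp [rdeg])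
    | cons => exact Submodule.zero_mem _

/-- The inverse dualizing bimodule `C^!(A, B) = hom_{C-C}(C_Δ, Y_{A,B})`. -/
def dual (C : AInfCat.{u, v, w} K G) : PreBimod.{u, v, w, max u w} C where
  M A B := { V := fun d => HomSub (diag C) (yon C A B) d }
  act A A' B B' r l := DirectSum.toModule K G _ fun d =>
    GrMod.inj { V := fun d => HomSub (diag C) (yon C A B') d } (d + r.rdeg + l.rdeg + deg1 G) ∘ₗ
      (dualAct d r l).restrict fun _ hφ => dualAct_mem r l hφ

end PreBimod

/-! ### Copairing shadows -/

namespace PreBimod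

section Restriction

variable {P : AInfCat.{u, v, w} K G} {S : Set P.Obj}

/-- Restriction of pre-morphisms `P_Δ → Y_{A,B}` to the full subcategory on `S`. -/
def resMor (A B : S) :
    Cochain (diag P) (yon P A B) →ₗ[K] Cochain (diag (P.full S)) (yon (P.full S) A B) where
  toFun φ X X' Y Y' p q := φ X.1 X'.1 Y.1 Y'.1 (Pth.emb (S := S) p) (Pth.emb (S := S) q)
  map_add' _ _ := rfl
  map_smul' _ _ := rfl

theorem resMor_mem (A B : S) {d : G} {φ : Cochain (diag P) (yon P A B)}
    (hφ : φ ∈ HomSub (diag P) (yon P A B) d) :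
    resMor A B φ ∈ HomSub (diag (P.full S)) (yon (P.full S) A B) d := by
  refine ⟨fun X X' Y Y' q => ?_, fun X X' Y Y' p => ?_, fun X X' Y Y' p q => ?_⟩
  · exact PLin.emb (S := S) (X := X) (Y := X') (hφ.1 _ _ _ _ (Pth.emb (S := S) q))
  · exact PLin.emb (S := S) (X := Y) (Y := Y') (hφ.2.1 _ _ _ _ (Pth.emb (S := S) p))
  · have h := hφ.2.2 _ _ _ _ (Pth.emb (S := S) p) (Pth.emb (S := S) q)
    rw [rdeg_emb (S := S) p, rdeg_emb (S := S) q] at h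
    exact h

/-- The restriction map `P^!(A, B) → C^!(A, B)`, where `C` is the full subcategory on `S`. -/
def resDual (A B : S) : ((dual P).M A B).Tot →ₗ[K] ((dual (P.full S)).M A B).Tot :=
  DirectSum.toModule K G _ fun d =>
    ((dual (P.full S)).M A B).inj d ∘ₗ (resMor A B).restrict fun _ hφ => resMor_mem A B hφ

/-- Restriction of `P_Δ → P^!` to the full subcategory `C` on `S`, followed by `P^!|_C → C^!`. -/
def res (S : Set P.Obj) (F : Cochain (diag P) (dual P)) :
    Cochain (diag (P.full S)) (dual (P.full S)) := fun A A' B B' r l =>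
  resDual A B' ∘ₗ F A.1 A'.1 B.1 B'.1 (Pth.emb (S := S) r) (Pth.emb (S := S) l)

end Restriction

variable (P : AInfCat.{u, v, w} K G)

/-- The element `(F_{B,B}(e_B))_{A,A}(e_A)` of `hom(A, B) ⊗ hom(B, A)`, for `F : P_Δ → P^!` of
degree `d`. -/
def shadowElt (d : G) (F : Cochain (diag P) (dual P)) {A B : P.Obj} (eA : (P.Hom A A).V 0)
    (eB : (P.Hom B B).V 0) : (tens (P.Hom A B) (P.Hom B A)).Tot :=
  ((F B B B B (nil B) (nil B) ((P.Hom B B).inj 0 eB) : ((dual P).M B B).Tot) d :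
    HomSub (diag P) (yon P B B) d).1 A A A A (nil A) (nil A) ((P.Hom A A).inj 0 eA)

/-- The differential of `Y_{B,B}(A, A) = hom(A, B) ⊗ hom(B, A)`. -/
def tensD (A B : P.Obj) :
    (tens (P.Hom A B) (P.Hom B A)).Tot →ₗ[K] (tens (P.Hom A B) (P.Hom B A)).Tot :=
  (yon P B B).act A A A A (nil A) (nil A)

/-- `c ∈ H^*(hom(A, B)) ⊗ H^*(hom(B, A))` is the copairing shadow of a closed morphism
`F : P_Δ → P^!` of degree `d` at `(A, B)`: under the Künneth isomorphism, `c` is the class of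
`(F_{B,B}(e_B))_{A,A}(e_A)`, where `e_A` and `e_B` are cohomological units. -/
def IsCopairingShadow (d : G) (F : Cochain (diag P) (dual P)) (A B : P.Obj)
    (c : P.H A B ⊗[K] P.H B A) : Prop :=
  ∃ eA eB, P.IsCohUnit A eA ∧ P.IsCohUnit B eB ∧
    ∃ t : P.Z A B ⊗[K] P.Z B A,
      TensorProduct.map (P.cls A B) (P.cls B A) t = c ∧
      ∃ y : (tens (P.Hom A B) (P.Hom B A)).Tot,
        TensorProduct.lift ((tmk (P.Hom A B) (P.Hom B A)).compl₁₂ (P.Z A B).subtype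
          (P.Z B A).subtype) t =
          shadowElt P d F eA eB + tensD P A B y

variable {P}

/-- The family `c` consists of the copairing shadows, at all pairs of objects of `P`, of the closed
morphism `f : C_Δ → C^!` of degree `d`, where `C` is the full subcategory of `P` on `S`: there is a
closed morphism `F : P_Δ → P^!` which restricts to `f` up to homotopy, and `c` consists of the
copairing shadows of `F`. -/
def IsShadowFamily (S : Set P.Obj) (d : G)
    (f : Cochain (diag (P.full S)) (dual (P.full S)))
    (c : ∀ A B : P.Obj, P.H A B ⊗[K] P.H B A) : Prop :=
  ∃ F : Cochain (diag P) (dual P), IsClosedMor d F ∧ Homotopic d (res S F) f ∧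
    ∀ A B, IsCopairingShadow P d F A B (c A B)

end PreBimod

/-! ### The pre-triangulated split-closure -/

namespace AInfCat

variable (P : AInfCat.{u, v, w} K G)

/-- The classes of degree `k` in `H^*(hom(X, Y))`. -/
def Hdeg (k : G) (X Y : P.Obj) : Submodule K (P.H X Y) :=
  Submodule.map (P.cls X Y) (Submodule.comap (P.Z X Y).subtype
    (LinearMap.range ((P.Hom X Y).inj k)))

/-- `A` is an idempotent summand of `B`: there are degree-zero classes `[i] : A → B` and
`[p] : B → A` in the cohomology category with `[p] ∘ [i] = [id_A]`. -/
def IsSummand (A B : P.Obj) : Prop :=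
  ∃ i ∈ P.Hdeg 0 A B, ∃ p ∈ P.Hdeg 0 B A, P.hcmp A B A p i = P.hid A

/-- `Y` is isomorphic to the shift `X[1]`: there is an invertible class `X → Y` of degree `-1`. -/
def IsShift (X Y : P.Obj) : Prop :=
  ∃ a ∈ P.Hdeg (-deg1 G) X Y, ∃ b ∈ P.Hdeg (deg1 G) Y X,
    P.hcmp X Y X b a = P.hid X ∧ P.hcmp Y X Y a b = P.hid Y

/-- `T` is a mapping cone of the closed degree-zero morphism `a : X → Y`. Here `(h, j)` is a closed
degree-zero morphism to `T` from the twisted complex `X[1] ⊕ Y` with differential `a`, and the two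
last conditions say that it induces isomorphisms
`H^*(hom(W, X[1] ⊕ Y)) → H^*(hom(W, T))` for all objects `W` (surjectivity and injectivity). -/
def IsCone {X Y : P.Obj} (a : (P.Hom X Y).V 0) (T : P.Obj) : Prop :=
  ∃ (h : (P.Hom X T).V (-deg1 G)) (j : (P.Hom Y T).V 0),
    P.μ₁ j = 0 ∧ P.μ₁ h + P.μ₂ a j = 0 ∧
    (∀ (W : P.Obj) (k : G) (z : (P.Hom W T).V k), P.μ₁ z = 0 →
      ∃ (x : (P.Hom W X).V (k + deg1 G)) (y : (P.Hom W Y).V k) (z' : (P.Hom W T).V (k - deg1 G)),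
        P.μ₁ x = 0 ∧ P.μ₁ y + P.μ₂ x a = 0 ∧
          (P.Hom W T).inj k z = P.μ₂ x h + P.μ₃ x a j + P.μ₂ y j + P.μ₁ z') ∧
    (∀ (W : P.Obj) (k : G) (x : (P.Hom W X).V (k + deg1 G)) (y : (P.Hom W Y).V k)
      (z' : (P.Hom W T).V (k - deg1 G)), P.μ₁ x = 0 → P.μ₁ y + P.μ₂ x a = 0 →
      P.μ₂ x h + P.μ₃ x a j + P.μ₂ y j = P.μ₁ z' →
      ∃ (x' : (P.Hom W X).V k) (y' : (P.Hom W Y).V (k - deg1 G)),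
        (P.Hom W X).inj (k + deg1 G) x = P.μ₁ x' ∧
          (P.Hom W Y).inj k y = P.μ₁ y' + P.μ₂ x' a)

/-- The objects split-generated by `S`: the smallest class of objects containing `S` and zero
objects, and closed under shifts in both directions, mapping cones and idempotent summands. -/
inductive SplitGen (S : Set P.Obj) : P.Obj → Prop
  | base {X : P.Obj} (h : X ∈ S) : SplitGen S X
  | zero {X : P.Obj} (h : P.hid X = 0) : SplitGen S X
  | shift {X Y : P.Obj} (hX : SplitGen S X) (h : P.IsShift X Y) : SplitGen S Y
  | unshift {X Y : P.Obj} (hY : SplitGen S Y) (h : P.IsShift X Y) : SplitGen S X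
  | cone {X Y T : P.Obj} (hX : SplitGen S X) (hY : SplitGen S Y) (a : (P.Hom X Y).V 0)
      (ha : P.μ₁ a = 0) (h : P.IsCone a T) : SplitGen S T
  | summand {X Y : P.Obj} (hX : SplitGen S X) (h : P.IsSummand Y X) : SplitGen S Y

/-- `P` is the pre-triangulated split-closure of its full subcategory on `S`: it has a zero object,
shifts, and mapping cones, idempotents in its degree-zero cohomology category split, and it is
split-generated by `S`. -/
structure IsPerfClosure (S : Set P.Obj) : Prop where
  zero : ∃ X, P.hid X = 0
  shift : ∀ X, ∃ Y, P.IsShift X Y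
  unshift : ∀ Y, ∃ X, P.IsShift X Y
  cone : ∀ (X Y : P.Obj) (a : (P.Hom X Y).V 0), P.μ₁ a = 0 → ∃ T, P.IsCone a T
  split : ∀ X, ∀ e ∈ P.Hdeg 0 X X, P.hcmp X X X e e = e →
    ∃ Y, ∃ i ∈ P.Hdeg 0 Y X, ∃ p ∈ P.Hdeg 0 X Y,
      P.hcmp Y X Y p i = P.hid Y ∧ P.hcmp X Y X i p = e
  gen : ∀ X, P.SplitGen S X

end AInfCat

/-! ### Hochschild chains, smoothness and weak Calabi-Yau structures -/

namespace PreBimod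

/-- A strict short exact sequence `0 → M' → M → M'' → 0` of bimodules. -/
def StrictExact {C : AInfCat.{u, v, w} K G} (M' M M'' : PreBimod.{u, v, w, w} C) : Prop :=
  ∃ (ι : ∀ X Y, (M'.M X Y).Tot →ₗ[K] (M.M X Y).Tot)
    (π : ∀ X Y, (M.M X Y).Tot →ₗ[K] (M''.M X Y).Tot),
    (∀ X Y, ι X Y ∈ HDeg _ _ 0 ∧ π X Y ∈ HDeg _ _ 0 ∧ Function.Injective (ι X Y) ∧
      Function.Surjective (π X Y) ∧ LinearMap.range (ι X Y) = LinearMap.ker (π X Y)) ∧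
    ∀ X X' Y Y' (p : Pth C.Hom X X') (q : Pth C.Hom Y Y'),
      M.act X X' Y Y' p q ∘ₗ ι X' Y = ι X Y' ∘ₗ M'.act X X' Y Y' p q ∧
      M''.act X X' Y Y' p q ∘ₗ π X' Y = π X Y' ∘ₗ M.act X X' Y Y' p q

/-- Perfect bimodules: the smallest class of A∞ bimodules containing the Yoneda bimodules and zero
bimodules and closed under homotopy equivalences, shifts in both directions, extensions (hence
mapping cones), and homotopy retracts. -/
inductive IsPerfect {C : AInfCat.{u, v, w} K G} : PreBimod.{u, v, w, w} C → Prop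
  | yon (A B : C.Obj) : IsPerfect (yon C A B)
  | zero (M : PreBimod.{u, v, w, w} C) (hM : M.IsBimod) (h : Homotopic 0 (idMor M) 0) :
      IsPerfect M
  | shift (M N : PreBimod.{u, v, w, w} C) (hM : IsPerfect M) (hN : N.IsBimod) (d : G)
      (hd : d = deg1 G ∨ d = -deg1 G) (φ : Cochain M N) (ψ : Cochain N M)
      (hφ : IsClosedMor d φ) (hψ : IsClosedMor (-d) ψ) (h : IsHomotopyInverse d φ ψ) :
      IsPerfect N
  | ext (M' M M'' : PreBimod.{u, v, w, w} C) (h' : IsPerfect M') (h'' : IsPerfect M'')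
      (hM : M.IsBimod) (h : StrictExact M' M M'') : IsPerfect M
  | retract (M N : PreBimod.{u, v, w, w} C) (hM : IsPerfect M) (hN : N.IsBimod)
      (i : Cochain N M) (p : Cochain M N) (hi : IsClosedMor 0 i) (hp : IsClosedMor 0 p)
      (h : Homotopic 0 (comp 0 p i) (idMor N)) : IsPerfect N

variable (C : AInfCat.{u, v, w} K G)

/-- Cyclically composable strings `x ⊗ c` of homogeneous elements: `x ∈ hom(X, Y)` and a string
`c : Y → … → X`. -/
structure HString where
  X : C.Obj
  Y : C.Obj
  g : G
  x : (C.Hom X Y).V g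
  c : Pth C.Hom Y X

variable {C}

/-- The degree `|x| + ‖c‖`. -/
def HString.deg (s : HString C) : G := s.g + s.c.rdeg

/-- The Hochschild differential of a string. -/
def HString.b : HString C → (HString C →₀ K)
  | ⟨X, Y, g, x, c⟩ =>
    ksgn (par g) • barSum C.μ (fun c' => Finsupp.single ⟨X, Y, g, x, c'⟩ (1 : K)) c +
    splitSum c fun Z₁ c₁ c' => splitSum c' fun Z₂ c₂ c₃ =>
      ksgn (par c₃.rdeg * (par g + par c₁.rdeg + par c₂.rdeg)) •
        Finsupp.single ⟨Z₂, Z₁, g + c₃.rdeg + c₁.rdeg + deg1 G,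
          (diagAct C c₃ c₁ ((C.Hom X Y).inj g x)) (g + c₃.rdeg + c₁.rdeg + deg1 G), c₂⟩ (1 : K)

variable (C) in
/-- The multilinearity relations: the Hochschild chains `⨁ hom(X, Y) ⊗ hom(Y, X₁) ⊗ … ⊗ hom(X_k, X)`
are the formal linear combinations of strings modulo these. -/
def hochRel : Submodule K (HString C →₀ K) :=
  Submodule.span K
    ({z | ∃ (X Y : C.Obj) (g : G) (x x' : (C.Hom X Y).V g) (c : Pth C.Hom Y X),
        z = Finsupp.single ⟨X, Y, g, x + x', c⟩ 1 - Finsupp.single ⟨X, Y, g, x, c⟩ 1 -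
          Finsupp.single ⟨X, Y, g, x', c⟩ 1} ∪
     {z | ∃ (X Y : C.Obj) (g : G) (k : K) (x : (C.Hom X Y).V g) (c : Pth C.Hom Y X),
        z = Finsupp.single ⟨X, Y, g, k • x, c⟩ 1 - Finsupp.single ⟨X, Y, g, x, c⟩ k} ∪
     {z | ∃ (X Y A B : C.Obj) (g h : G) (x : (C.Hom X Y).V g) (s : Pth C.Hom Y A)
        (a a' : (C.Hom A B).V h) (t : Pth C.Hom B X),
        z = Finsupp.single ⟨X, Y, g, x, s.append (cons h (a + a') t)⟩ 1 -
          Finsupp.single ⟨X, Y, g, x, s.append (cons h a t)⟩ 1 -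
          Finsupp.single ⟨X, Y, g, x, s.append (cons h a' t)⟩ 1} ∪
     {z | ∃ (X Y A B : C.Obj) (g h : G) (x : (C.Hom X Y).V g) (s : Pth C.Hom Y A) (k : K)
        (a : (C.Hom A B).V h) (t : Pth C.Hom B X),
        z = Finsupp.single ⟨X, Y, g, x, s.append (cons h (k • a) t)⟩ 1 -
          Finsupp.single ⟨X, Y, g, x, s.append (cons h a t)⟩ k})

/-- `σ` represents a Hochschild homology class of (cohomological) degree `d`. -/
def IsHochschildCycle (d : G) (σ : HString C →₀ K) : Prop :=
  (∀ s ∈ σ.support, s.deg = d) ∧ (σ.sum fun s k => k • s.b) ∈ hochRel C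

/-- The map `v ⊗ w ↦ ± μ(r, w, c, v, l)`, where the sign is `(-1)^{e(|v|, |w|)}`. -/
def contract (e : ZMod 2 → ZMod 2 → ZMod 2) {A' A B B' Z₁ Z₂ : C.Obj} (r : Pth C.Hom A' A)
    (c : Pth C.Hom Z₁ Z₂) (l : Pth C.Hom B B') :
    (tens (C.Hom Z₂ B) (C.Hom A Z₁)).Tot →ₗ[K] (C.Hom A' B').Tot :=
  tlift fun i j => ksgn (e (par i) (par j)) •
    LinearMap.mk₂ K (fun v w => C.μ (r.append (cons j w (c.append (cons i v l)))))
      (fun v v' w => by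
        obtain ⟨L, hL⟩ := C.μ_lin Z₂ B (r.append (cons j w c)) l i
        simp only [append_assoc, cons_append] at hL
        simp only [hL, map_add])
      (fun k v w => by
        obtain ⟨L, hL⟩ := C.μ_lin Z₂ B (r.append (cons j w c)) l i
        simp only [append_assoc, cons_append] at hL
        simp only [hL, map_smul])
      (fun v w w' => by
        obtain ⟨L, hL⟩ := C.μ_lin A Z₁ r (c.append (cons i v l)) j
        simp only [hL, map_add])
      (fun k v w => by
        obtain ⟨L, hL⟩ := C.μ_lin A Z₁ r (c.append (cons i v l)) j
        simp only [hL, map_smul])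

/-- The value `φ(p; x; q)` as a linear function of the pre-morphism `φ`. -/
def evalAt (A B : C.Obj) (d : G) {X X' Y Y' : C.Obj} (p : Pth C.Hom X X') (q : Pth C.Hom Y Y')
    (x : (C.Hom X' Y).Tot) :
    HomSub (diag C) (yon C A B) d →ₗ[K] (tens (C.Hom X B) (C.Hom A Y')).Tot where
  toFun φ := φ.1 X X' Y Y' p q x
  map_add' _ _ := rfl
  map_smul' _ _ := rfl

/-- The bimodule morphism `C^! → C_Δ` given by capping with the string `x ⊗ c`:
`(r; φ; l) ↦ ∑ ± μ(r, w, c₂, v, l)`, where `∑ v ⊗ w = φ(c₃; x; c₁)` and the sum is over all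
decompositions `c = c₁ c₂ c₃`. The sign is the Koszul sign. -/
def HString.ev : HString C → Cochain (dual C) (diag C)
  | ⟨X, Y, g, x, c⟩ => fun A' A B B' r l => DirectSum.toModule K G _ fun d =>
    splitSum c fun Z₁ c₁ c' => splitSum c' fun Z₂ c₂ c₃ =>
      contract (fun v w =>
          par c₃.rdeg * (par g + par c₁.rdeg + par c₂.rdeg) +
          par d * (par c₃.rdeg + par g + par c₁.rdeg + par c₂.rdeg + par r.rdeg) +
          v * (w + par c₂.rdeg) + par r.rdeg * (w + par c₂.rdeg + v) + w + par c₂.rdeg)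
        r c₂ l ∘ₗ evalAt A B d c₃ c₁ ((C.Hom X Y).inj g x)

/-- The morphism `ev(σ) : C^! → C_Δ` given by capping with `σ`. -/
def ev (σ : HString C →₀ K) : Cochain (dual C) (diag C) := σ.sum fun s k => k • s.ev

/-- `f : C_Δ → C^!` is a closed morphism of degree `d` inverse in cohomology to `ev(σ)`. -/
def IsInverseOfEv (d : G) (σ : HString C →₀ K) (f : Cochain (diag C) (dual C)) : Prop :=
  IsClosedMor d f ∧ IsHomotopyInverse d f (ev σ)

/-- `σ` is a weak smooth Calabi-Yau structure of dimension `d` on `C`: the category `C` is smooth,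
`σ` is a Hochschild cycle of degree `-d`, and `ev(σ)` is an isomorphism in cohomology. -/
def IsWeakSmoothCY (d : G) (σ : HString C →₀ K) : Prop :=
  IsPerfect (diag C) ∧ IsHochschildCycle (-d) σ ∧ ∃ f, IsInverseOfEv d σ f

end PreBimod

end Graded
end OpenString
end

noncomputable section

open scoped DirectSum TensorProduct

set_option linter.unusedSectionVars false

namespace OpenString

open Pth

variable {K : Type v} [Field K] {G : Type} [GradingDatum G] [DecidableEq G]

/-! ### Signs and homogeneous elements -/

/-! The copairing shadows of a closed morphism are natural in both objects, and entire degeneracy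
passes to summands by naturality along the inclusion. Write `i : M → L` and `p : L → M` with `p ∘ i
= id`. Naturality in the first object gives `(id ⊗ (i ∘ -))(c_{M,M}) = ((- ∘ i) ⊗ id)(c_{L,M})`, and
naturality in the second gives `((i ∘ -) ⊗ id)(c_{L,M}) = (id ⊗ (- ∘ i))(c_{L,L})`. For a functional
`φ` on `H(M, M)` put `ψ(y) = φ(p ∘ y ∘ i)`, a functional on `H(L, L)`. Let `w = (φ ⊗ id)(c_{M,M})`
and `u = (ψ ⊗ id)(c_{L,L})`. Since `ψ(i ∘ a) = φ(a ∘ i)`, the two identities combine to `i ∘ w = u ∘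
i`. Hence `i ∘ w^n = u^n ∘ i` and `w^n = p ∘ u^n ∘ i`, so `w` is nilpotent as soon as `u` is.

Both naturalities are instances of one fact, `IsClosedMor.diag_natural`: for a closed morphism `φ :
C_Δ → N` and a degree-zero cocycle `x : X → Y`, the actions of `x` on `φ(e_X)` and on `φ(e_Y)` agree
up to sign and boundary, because both compute `φ(x)`. With `N` a Yoneda bimodule and `φ = F(e_B)`
this is naturality in the first object (`map_valAt_eq`). With `N = C^!` and `φ = F`, followed by
evaluation at `e_A`, it is naturality in the second (`map_unitImage_eq`). These are equalities of
cochains modulo boundaries. They are transported to `H ⊗ H` by `kunneth`, which kills boundaries and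
inverts the Künneth map on classes (`Represents.kunneth_tmap`). The nilpotence argument is
`EntirelyDegenerate.summand`. -/

theorem ksgn_mul_self (x : ZMod 2) : ksgn x * ksgn x = 1 := by revert x; decide

theorem ksgn_smul_ksgn_smul {W : Type w₁} [AddCommGroup W] (x : ZMod 2) (m : W) :
    ksgn x • ksgn x • m = m := by
  rw [smul_smul, ksgn_mul_self, one_smul]

theorem par_zero : par (0 : G) = 0 := map_zero GradingDatum.parity

theorem par_add (g h : G) : par (g + h) = par g + par h := map_add GradingDatum.parity g h

/-- A degree-zero entry has reduced degree `-1`. This odd parity is the source of every sign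
attached below to a string of one entry. -/
theorem par_rdeg_single {O : Type u} {H : O → O → GrMod.{v, w} K G} {X Y : O}
    (x : (H X Y).V 0) : par (cons 0 x (nil Y)).rdeg = 1 := by
  simp only [rdeg, add_zero]
  rw [AInfCat.par_sub_deg1, par_zero, zero_add]

theorem GrMod.inj_apply_of_mem {A : GrMod.{v, w} K G} {k : G} {x : A.Tot}
    (h : x ∈ LinearMap.range (A.inj k)) : A.inj k (x k) = x := by
  obtain ⟨a, rfl⟩ := h
  rw [GrMod.inj, DirectSum.lof_apply]

theorem GrMod.inj_injective (A : GrMod.{v, w} K G) (k : G) : Function.Injective (A.inj k) :=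
  DirectSum.of_injective (β := A.V) k

theorem GrMod.tot_ext {A : GrMod.{v, w} K G} {W : Type w₁} [AddCommGroup W] [Module K W]
    {f f' : A.Tot →ₗ[K] W} (h : ∀ g a, f (A.inj g a) = f' (A.inj g a)) : f = f' :=
  DirectSum.linearMap_ext K fun g => LinearMap.ext fun a => h g a

theorem GrMod.tw_tw (A : GrMod.{v, w} K G) (x : ZMod 2) : A.tw x ∘ₗ A.tw x = LinearMap.id :=
  GrMod.tot_ext fun g a => by
    rw [LinearMap.comp_apply, GrMod.tw_inj, map_zsmul, GrMod.tw_inj, ksgn_smul_ksgn_smul]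
    rfl

theorem GrMod.tw_zero (A : GrMod.{v, w} K G) : A.tw 0 = LinearMap.id :=
  GrMod.tot_ext fun g a => by
    rw [GrMod.tw_inj, zero_mul]
    exact one_smul ℤ _

theorem tmap_tmk {A B A' B' : GrMod.{v, w} K G} (α : A.Tot →ₗ[K] A'.Tot)
    (β : B.Tot →ₗ[K] B'.Tot) (a : A.Tot) (b : B.Tot) :
    tmap α β (tmk A B a b) = tmk A' B' (α a) (β b) := by
  suffices h : (tmk A B).compr₂ (tmap α β) = (tmk A' B').compl₁₂ α β from
    LinearMap.congr_fun (LinearMap.congr_fun h a) b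
  refine GrMod.tot_ext fun i a => GrMod.tot_ext fun j b => ?_
  simp only [LinearMap.compr₂_apply, LinearMap.compl₁₂_apply, tmk_inj, tmap_tmk₀]

theorem tmap_comp {A B A' B' A'' B'' : GrMod.{v, w} K G} (α : A.Tot →ₗ[K] A'.Tot)
    (β : B.Tot →ₗ[K] B'.Tot) (α' : A'.Tot →ₗ[K] A''.Tot) (β' : B'.Tot →ₗ[K] B''.Tot) :
    tmap α' β' ∘ₗ tmap α β = tmap (α' ∘ₗ α) (β' ∘ₗ β) := by
  refine tens_ext fun i j a b => ?_
  rw [LinearMap.comp_apply, tmap_tmk₀, tmap_tmk, tmap_tmk₀]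
  rfl

/-- Parity is additive on tensors. Twisting both factors is therefore a scalar on each homogeneous
part of the tensor product, which is how the factorwise signs of the Yoneda bimodule become a global
one. -/
theorem tmap_tw_tw (A B : GrMod.{v, w} K G) (x : ZMod 2) :
    tmap (A.tw x) (B.tw x) = (tens A B).tw x := by
  refine tens_ext fun i j a b => ?_
  rw [tmap_tmk₀, GrMod.tw_inj, GrMod.tw_inj, map_zsmul, map_zsmul, LinearMap.smul_apply, tmk_inj,
    smul_smul]
  have e : (tens A B).tw x (tmk₀ A B i j a b) = ksgn (x * par (i + j)) • tmk₀ A B i j a b :=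
    GrMod.tw_inj _ x (i + j) _
  have h : ∀ x s t : ZMod 2, ksgn (x * t) * ksgn (x * s) = ksgn (x * (s + t)) := by decide
  rw [e, par_add, h]

namespace PreBimod

variable {C : AInfCat.{u, v, w} K G}

/-! ### Closed bimodule morphisms on short strings -/

section Closed

variable {M : PreBimod.{u, v, w, w₁} C} {N : PreBimod.{u, v, w, w₂} C} {d : G} {φ : Cochain M N}

/-- Naturality only involves the closedness equation on strings of total length at most one. This
lemma and the next two list the few decompositions occurring there. -/
theorem comp_nil_nil (e : ZMod 2) {Q : PreBimod.{u, v, w, w₃} C} (φ : Cochain N Q)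
    (ψ : Cochain M N) (X Y : C.Obj) (m : (M.M X Y).Tot) :
    comp e φ ψ X X Y Y (nil X) (nil Y) m =
      φ X X Y Y (nil X) (nil Y) (ψ X X Y Y (nil X) (nil Y) m) := by
  simp [comp, splitSum, rdeg, par_zero, ksgn]

theorem comp_nil_single (e : ZMod 2) {Q : PreBimod.{u, v, w, w₃} C} (φ : Cochain N Q)
    (ψ : Cochain M N) {X Y Y' : C.Obj} (x : (C.Hom Y Y').V 0) (m : (M.M X Y).Tot) :
    comp e φ ψ X X Y Y' (nil X) (cons 0 x (nil Y')) m =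
      φ X X Y Y' (nil X) (cons 0 x (nil Y')) (ψ X X Y Y (nil X) (nil Y) m) +
      φ X X Y' Y' (nil X) (nil Y') (ψ X X Y Y' (nil X) (cons 0 x (nil Y')) m) := by
  simp [comp, splitSum, rdeg, par_zero, ksgn]

/-- Only the decomposition in which `φ` receives `x` carries a sign: there `ψ`, of parity `e`, moves
past the odd string `x`. -/
theorem comp_single_nil (e : ZMod 2) {Q : PreBimod.{u, v, w, w₃} C} (φ : Cochain N Q)
    (ψ : Cochain M N) {X X' Y : C.Obj} (x : (C.Hom X X').V 0) (m : (M.M X' Y).Tot) :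
    comp e φ ψ X X' Y Y (cons 0 x (nil X')) (nil Y) m =
      φ X X Y Y (nil X) (nil Y) (ψ X X' Y Y (cons 0 x (nil X')) (nil Y) m) +
      ksgn e • φ X X' Y Y (cons 0 x (nil X')) (nil Y) (ψ X' X' Y Y (nil X') (nil Y) m) := by
  have h := par_rdeg_single (K := K) (H := C.Hom) x
  simp only [comp, splitSum, h, LinearMap.add_apply, LinearMap.smul_apply, LinearMap.comp_apply]
  simp [rdeg, par_zero, ksgn]

/-- The only insertion is that of `μ` of the empty string, which is zero; multilinearity turns a
zero entry into a zero value. -/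
theorem barSum_nil {W : Type w₃} [AddCommGroup W] [Module K W] {X : C.Obj}
    {F : Pth C.Hom X X → W} (hF : PLin F) : barSum C.μ F (nil X) = 0 := by
  -- The degree is the one in which `barSum` inserts `μ` of a string of reduced degree zero.
  obtain ⟨L, hL⟩ := hF X X (nil X) (nil X) (0 + deg1 G + deg1 G)
  simp only [barSum, splitSum, rdeg, C.μ_nil, nil_append] at hL ⊢
  rw [hL, DirectSum.zero_apply, map_zero, smul_zero]

/-- Each insertion is `μ` of an empty string or `μ¹ x`, and both vanish. -/
theorem barSum_single {W : Type w₃} [AddCommGroup W] [Module K W] {X Y : C.Obj}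
    {F : Pth C.Hom X Y → W} (hF : PLin F) {x : (C.Hom X Y).V 0} (hx : C.μ₁ x = 0) :
    barSum C.μ F (cons 0 x (nil Y)) = 0 := by
  have h : ∀ (A B : C.Obj) (s : Pth C.Hom X A) (t : Pth C.Hom B Y) (g : G),
      F (s.append (cons g 0 t)) = 0 := by
    intro A B s t g
    obtain ⟨L, hL⟩ := hF A B s t g
    rw [hL, map_zero]
  rw [AInfPre.μ₁] at hx
  simp only [barSum, splitSum, C.μ_nil, hx, DirectSum.zero_apply, h, smul_zero, add_zero]

/-- The length-zero part of closedness: the leading term of `φ` is a chain map up to the sign of its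
degree. -/
theorem IsClosedMor.nil_nil (hφ : IsClosedMor d φ) (X Y : C.Obj) (m : (M.M X Y).Tot) :
    N.act X X Y Y (nil X) (nil Y) (φ X X Y Y (nil X) (nil Y) m) =
      ksgn (par d) • φ X X Y Y (nil X) (nil Y) (M.act X X Y Y (nil X) (nil Y) m) := by
  have h := LinearMap.congr_fun
    (congrFun (congrFun (congrFun₂ (congrFun₂ hφ.2 X X) Y Y) (nil X)) (nil Y)) m
  change comp (par d) N.act φ X X Y Y (nil X) (nil Y) m -
    (ksgn (par d) • preB φ X X Y Y (nil X) (nil Y)) m = 0 at h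
  rw [LinearMap.smul_apply, preB, LinearMap.add_apply, LinearMap.add_apply, comp_nil_nil,
    comp_nil_nil, barSum_nil (hφ.1.1 X X Y Y (nil Y)), barSum_nil (hφ.1.2.1 X X Y Y (nil X))] at h
  simpa [sub_eq_zero] using h

/-- The leading term of `φ` commutes with the covariant action of `x` up to the homotopy `φ(∅; m;
x)`. The terms `φ(∅; m; μ¹ x)` and `φ(∅; D m; x)` of the full equation vanish for cocycles `x` and
`m`. -/
theorem IsClosedMor.nil_single (hφ : IsClosedMor d φ) {X Y Y' : C.Obj} {x : (C.Hom Y Y').V 0}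
    (hx : C.μ₁ x = 0) (m : (M.M X Y).Tot) (hm : M.act X X Y Y (nil X) (nil Y) m = 0) :
    N.act X X Y Y' (nil X) (cons 0 x (nil Y')) (φ X X Y Y (nil X) (nil Y) m) +
      N.act X X Y' Y' (nil X) (nil Y') (φ X X Y Y' (nil X) (cons 0 x (nil Y')) m) =
      ksgn (par d) • φ X X Y' Y' (nil X) (nil Y')
        (M.act X X Y Y' (nil X) (cons 0 x (nil Y')) m) := by
  have h := LinearMap.congr_fun (congrFun (congrFun (congrFun₂ (congrFun₂ hφ.2 X X) Y Y') (nil X))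
    (cons 0 x (nil Y'))) m
  change comp (par d) N.act φ X X Y Y' (nil X) (cons 0 x (nil Y')) m -
    (ksgn (par d) • preB φ X X Y Y' (nil X) (cons 0 x (nil Y'))) m = 0 at h
  rw [LinearMap.smul_apply, preB, LinearMap.add_apply, LinearMap.add_apply, comp_nil_single,
    comp_nil_single, barSum_nil (hφ.1.1 X X Y Y' _),
    barSum_single (hφ.1.2.1 X X Y Y' (nil X)) hx, hm] at h
  simpa [sub_eq_zero] using h

/-- The contravariant counterpart. The additional sign on the first term comes from moving `φ`, of
degree `d`, past the odd string `x`. -/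
theorem IsClosedMor.single_nil (hφ : IsClosedMor d φ) {X X' Y : C.Obj} {x : (C.Hom X X').V 0}
    (hx : C.μ₁ x = 0) (m : (M.M X' Y).Tot) (hm : M.act X' X' Y Y (nil X') (nil Y) m = 0) :
    ksgn (par d) •
        N.act X X' Y Y (cons 0 x (nil X')) (nil Y) (φ X' X' Y Y (nil X') (nil Y) m) +
      N.act X X Y Y (nil X) (nil Y) (φ X X' Y Y (cons 0 x (nil X')) (nil Y) m) =
      ksgn (par d) • φ X X Y Y (nil X) (nil Y)
        (M.act X X' Y Y (cons 0 x (nil X')) (nil Y) m) := by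
  have h := LinearMap.congr_fun (congrFun (congrFun (congrFun₂ (congrFun₂ hφ.2 X X') Y Y)
    (cons 0 x (nil X'))) (nil Y)) m
  change comp (par d) N.act φ X X' Y Y (cons 0 x (nil X')) (nil Y) m -
    (ksgn (par d) • preB φ X X' Y Y (cons 0 x (nil X')) (nil Y)) m = 0 at h
  rw [LinearMap.smul_apply, preB, LinearMap.add_apply, LinearMap.add_apply, comp_single_nil,
    comp_single_nil, barSum_single (hφ.1.1 X X' Y Y _) hx,
    barSum_nil (hφ.1.2.1 X X' Y Y _), hm] at h
  rw [add_comm]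
  simpa [sub_eq_zero] using h

end Closed

/-! ### Closed morphisms out of the diagonal bimodule and their naturality -/

/-- The differential of the diagonal bimodule is `-μ¹`. -/
theorem diagAct_nil_nil (X Y : C.Obj) : diagAct C (nil X) (nil Y) = - C.d X Y := by
  simp [diagAct, rdeg, par_zero, ksgn, AInfCat.d]

/-- The twist removes the sign `(-1)^{|y|}` built into `cmp`; the minus sign is that of the diagonal
structure maps with empty left string. -/
theorem diagAct_nil_single {X Y Y' : C.Obj} (x : (C.Hom Y Y').V 0) :
    diagAct C (nil X) (cons 0 x (nil Y')) =
      - (C.cmp X Y Y' ((C.Hom Y Y').inj 0 x) ∘ₗ (C.Hom X Y).tw 1) := by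
  refine LinearMap.ext fun y => ?_
  have h : (C.Hom X Y).tw 1 ((C.Hom X Y).tw 1 y) = y := LinearMap.congr_fun (GrMod.tw_tw _ 1) y
  rw [LinearMap.neg_apply, LinearMap.comp_apply, AInfCat.cmp_inj, h]
  simp [diagAct, rdeg, par_zero, ksgn]

/-- Here the odd string `x` sits on the left and reverses the sign of the structure map. The
opposite signs of the two actions are what makes the two copies of `φ(x)` cancel in
`IsClosedMor.diag_natural`. -/
theorem diagAct_single_nil {X X' Y : C.Obj} (x : (C.Hom X X').V 0) :
    diagAct C (cons 0 x (nil X')) (nil Y) =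
      (C.cmp X X' Y).flip ((C.Hom X X').inj 0 x) := by
  refine LinearMap.ext fun y => ?_
  rw [LinearMap.flip_apply, AInfCat.cmp_apply_inj, diagAct, par_rdeg_single]
  simp [par_zero, ksgn]

/-- The chain-map property rewritten with `μ¹`, so that boundaries of morphisms are visibly sent to
boundaries in `N`. It absorbs every ambiguity in the choice of units and representatives. -/
theorem IsClosedMor.diag_map_d {N : PreBimod.{u, v, w, w₂} C} {d : G} {φ : Cochain (diag C) N}
    (hφ : IsClosedMor d φ) (X Y : C.Obj) (y : (C.Hom X Y).Tot) :
    φ X X Y Y (nil X) (nil Y) (C.d X Y y) =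
      -(ksgn (par d) • N.act X X Y Y (nil X) (nil Y) (φ X X Y Y (nil X) (nil Y) y)) := by
  let Φ : (C.Hom X Y).Tot →ₗ[K] (N.M X Y).Tot := φ X X Y Y (nil X) (nil Y)
  let D : (N.M X Y).Tot →ₗ[K] (N.M X Y).Tot := N.act X X Y Y (nil X) (nil Y)
  change Φ (C.d X Y y) = -(ksgn (par d) • D (Φ y))
  have e : (diag C).act X X Y Y (nil X) (nil Y) y = - C.d X Y y := by
    change diagAct C (nil X) (nil Y) y = _
    rw [diagAct_nil_nil, LinearMap.neg_apply]
  have h : D (Φ y) = ksgn (par d) • Φ (- C.d X Y y) :=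
    (hφ.nil_nil X Y y).trans (congrArg (fun z => ksgn (par d) • Φ z) e)
  rw [h, ksgn_smul_ksgn_smul, map_neg, neg_neg]

theorem diag_act_unit {A : C.Obj} {e : (C.Hom A A).V 0} (h : C.IsCohUnit A e) :
    (diag C).act A A A A (nil A) (nil A) ((C.Hom A A).inj 0 e) = 0 := by
  change diagAct C (nil A) (nil A) ((C.Hom A A).inj 0 e) = 0
  rw [diagAct_nil_nil, LinearMap.neg_apply, AInfCat.d_inj, h.1, neg_zero]

/-- A closed morphism `φ : C_Δ → N` is natural up to boundaries: both `x · φ(e_Y)` and `φ(e_X) · x`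
represent `φ(x)`. -/
theorem IsClosedMor.diag_natural {N : PreBimod.{u, v, w, w₂} C} {d : G} {φ : Cochain (diag C) N}
    (hφ : IsClosedMor d φ) {X Y : C.Obj} {x : (C.Hom X Y).V 0} (hx : C.μ₁ x = 0)
    {eX : (C.Hom X X).V 0} (hX : C.IsCohUnit X eX) {eY : (C.Hom Y Y).V 0}
    (hY : C.IsCohUnit Y eY) :
    ∃ n, N.act X X X Y (nil X) (cons 0 x (nil Y))
        (φ X X X X (nil X) (nil X) ((C.Hom X X).inj 0 eX)) +
      ksgn (par d) • N.act X Y Y Y (cons 0 x (nil Y)) (nil Y)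
        (φ Y Y Y Y (nil Y) (nil Y) ((C.Hom Y Y).inj 0 eY)) =
      N.act X X Y Y (nil X) (nil Y) n := by
  -- Closedness is read at `(∅; e_X; x)` and at `(x; e_Y; ∅)`; in both cases the diagonal bimodule
  -- multiplies `x` by a unit.
  have h1 := hφ.nil_single (X := X) hx _ (diag_act_unit hX)
  have h2 := hφ.single_nil (Y := Y) hx _ (diag_act_unit hY)
  -- The units are only cohomological, so each product is `x` up to the boundary of `b` or `b'`.
  obtain ⟨b, hb⟩ := hX.2.1 Y 0 x hx
  obtain ⟨b', hb'⟩ := hY.2.2 X 0 x hx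
  have e1 : (diag C).act X X X Y (nil X) (cons 0 x (nil Y)) ((C.Hom X X).inj 0 eX) =
      -((C.Hom X Y).inj 0 x + C.d X Y ((C.Hom X Y).inj _ b)) := by
    change diagAct C _ _ _ = _
    rw [diagAct_nil_single, LinearMap.neg_apply, LinearMap.comp_apply, GrMod.tw_inj, map_zsmul,
      AInfCat.cmp_inj_inj, hb, AInfCat.d_inj]
    simp [par_zero, ksgn]
  have e2 : (diag C).act X Y Y Y (cons 0 x (nil Y)) (nil Y) ((C.Hom Y Y).inj 0 eY) =
      (C.Hom X Y).inj 0 x + C.d X Y ((C.Hom X Y).inj _ b') := by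
    change diagAct C _ _ _ = _
    rw [diagAct_single_nil, LinearMap.flip_apply, AInfCat.cmp_inj_inj, hb', AInfCat.d_inj]
  let Φ : (C.Hom X Y).Tot →ₗ[K] (N.M X Y).Tot := φ X X Y Y (nil X) (nil Y)
  let D : (N.M X Y).Tot →ₗ[K] (N.M X Y).Tot := N.act X X Y Y (nil X) (nil Y)
  have e3 : ∀ y, Φ (C.d X Y y) = -(ksgn (par d) • D (Φ y)) := hφ.diag_map_d X Y
  have h1' := eq_sub_of_add_eq (h1.trans (congrArg (fun z => ksgn (par d) • Φ z) e1))
  have h2' := eq_sub_of_add_eq (h2.trans (congrArg (fun z => ksgn (par d) • Φ z) e2))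
  rw [h1', h2', map_neg, map_add, map_add, e3, e3]
  -- After `φ(x)` cancels, what remains are the images of the two unit corrections and the two
  -- homotopy terms of `φ`; their signed sum is the primitive.
  refine ⟨Φ ((C.Hom X Y).inj _ b) -
    φ X X X Y (nil X) (cons 0 x (nil Y)) ((C.Hom X X).inj 0 eX) -
    Φ ((C.Hom X Y).inj _ b') -
    φ X Y Y Y (cons 0 x (nil Y)) (nil Y) ((C.Hom Y Y).inj 0 eY), ?_⟩
  rw [map_sub, map_sub, map_sub]
  simp only [smul_neg, smul_add, ksgn_smul_ksgn_smul]
  abel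

end PreBimod

theorem GrMod.toModule_inj {A : GrMod.{v, w} K G} {W : Type w₁} [AddCommGroup W] [Module K W]
    (f : ∀ g, A.V g →ₗ[K] W) (g : G) (a : A.V g) :
    DirectSum.toModule K G W f (A.inj g a) = f g a := by
  rw [GrMod.inj, DirectSum.toModule_lof]

/-! ### The Künneth map -/

namespace AInfCat

variable (C : AInfCat.{u, v, w} K G)

/-- A linear extension of the class map from cocycles to all morphisms. -/
def clsExt (X Y : C.Obj) : (C.Hom X Y).Tot →ₗ[K] C.H X Y :=
  -- Over a field the cocycles have a complement. The values chosen on it are harmless: they are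
  -- only ever paired with the class of a boundary, which is zero.
  (LinearMap.exists_extend (C.cls X Y)).choose

variable {C} in
theorem clsExt_cocycle {X Y : C.Obj} (z : C.Z X Y) : C.clsExt X Y z = C.cls X Y z :=
  LinearMap.congr_fun (LinearMap.exists_extend (C.cls X Y)).choose_spec z

variable {C} in
theorem d_d {X Y : C.Obj} (x : (C.Hom X Y).Tot) : C.d X Y (C.d X Y x) = 0 := by
  suffices h : C.d X Y ∘ₗ C.d X Y = 0 from LinearMap.congr_fun h x
  refine GrMod.tot_ext fun g a => ?_
  rw [LinearMap.comp_apply, d_inj, rel₁]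
  rfl

variable {C} in
theorem clsExt_d {X Y : C.Obj} (x : (C.Hom X Y).Tot) : C.clsExt X Y (C.d X Y x) = 0 := by
  rw [show C.d X Y x = ((⟨C.d X Y x, d_d x⟩ : C.Z X Y) : (C.Hom X Y).Tot) from rfl,
    clsExt_cocycle, cls_eq_zero]
  exact ⟨x, rfl⟩

/-- The differential of `hom(X, Y) ⊗ hom(X', Y')`. -/
def tensDiff (X Y X' Y' : C.Obj) :
    (tens (C.Hom X Y) (C.Hom X' Y')).Tot →ₗ[K] (tens (C.Hom X Y) (C.Hom X' Y')).Tot :=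
  tmap (-C.d X Y) LinearMap.id + tmap ((C.Hom X Y).tw 1) (-C.d X' Y')

/-- A retraction of the Künneth map `H^*(hom(X, Y)) ⊗ H^*(hom(X', Y')) → H^*(hom ⊗ hom)`. -/
def kunneth (X Y X' Y' : C.Obj) :
    (tens (C.Hom X Y) (C.Hom X' Y')).Tot →ₗ[K] C.H X Y ⊗[K] C.H X' Y' :=
  tlift fun i j => (TensorProduct.mk K _ _).compl₁₂ (C.clsExt X Y ∘ₗ (C.Hom X Y).inj i)
    (C.clsExt X' Y' ∘ₗ (C.Hom X' Y').inj j)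

variable {C}

theorem kunneth_tmk {X Y X' Y' : C.Obj} (a : (C.Hom X Y).Tot) (b : (C.Hom X' Y').Tot) :
    C.kunneth X Y X' Y' (tmk _ _ a b) = C.clsExt X Y a ⊗ₜ[K] C.clsExt X' Y' b := by
  suffices h : (tmk _ _).compr₂ (C.kunneth X Y X' Y') =
      (TensorProduct.mk K _ _).compl₁₂ (C.clsExt X Y) (C.clsExt X' Y') from
    LinearMap.congr_fun (LinearMap.congr_fun h a) b
  refine GrMod.tot_ext fun i a => GrMod.tot_ext fun j b => ?_
  rw [LinearMap.compr₂_apply, tmk_inj, kunneth, tlift_tmk₀]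
  rfl

/-- Each term of the differential of `a ⊗ b` has a boundary in one factor, and `clsExt` kills it.
Hence cochain identities modulo boundaries become identities in `H ⊗ H` by applying `kunneth`,
without the full Künneth theorem. -/
theorem kunneth_tensDiff {X Y X' Y' : C.Obj} (y : (tens (C.Hom X Y) (C.Hom X' Y')).Tot) :
    C.kunneth X Y X' Y' (C.tensDiff X Y X' Y' y) = 0 := by
  suffices h : C.kunneth X Y X' Y' ∘ₗ C.tensDiff X Y X' Y' = 0 from LinearMap.congr_fun h y
  refine tens_ext fun i j a b => ?_
  rw [LinearMap.comp_apply, tensDiff, LinearMap.add_apply, tmap_tmk₀, tmap_tmk₀, map_add,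
    kunneth_tmk, kunneth_tmk]
  simp [clsExt_d]

/-! ### Represented classes and maps induced on them -/

/-- `c` is the class of the cocycle `t` of `hom(X, Y) ⊗ hom(X', Y')` under the Künneth
isomorphism. -/
def Represents {X Y X' Y' : C.Obj} (t : (tens (C.Hom X Y) (C.Hom X' Y')).Tot)
    (c : C.H X Y ⊗[K] C.H X' Y') : Prop :=
  ∃ z : C.Z X Y ⊗[K] C.Z X' Y', TensorProduct.map (C.cls X Y) (C.cls X' Y') z = c ∧
    ∃ y, TensorProduct.lift ((tmk (C.Hom X Y) (C.Hom X' Y')).compl₁₂ (C.Z X Y).subtype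
      (C.Z X' Y').subtype) z = t + C.tensDiff X Y X' Y' y

theorem Represents.of_eq_add {X Y X' Y' : C.Obj} {t t' : (tens (C.Hom X Y) (C.Hom X' Y')).Tot}
    {c : C.H X Y ⊗[K] C.H X' Y'} (h : Represents t c) (y : (tens (C.Hom X Y) (C.Hom X' Y')).Tot)
    (ht : t = t' + C.tensDiff X Y X' Y' y) : Represents t' c := by
  obtain ⟨z, hz, y', hy⟩ := h
  exact ⟨z, hz, y + y', by rw [hy, ht, map_add, add_assoc]⟩

/-- The usual uniqueness of units: the single product `μ₂ e e'` is cohomologous to `e'` because `e`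
is a unit and to `e` because `e'` is. -/
theorem IsCohUnit_sub {X : C.Obj} {e e' : (C.Hom X X).V 0} (he : C.IsCohUnit X e)
    (he' : C.IsCohUnit X e') :
    ∃ b, (C.Hom X X).inj 0 e = (C.Hom X X).inj 0 e' + C.d X X b := by
  obtain ⟨b, hb⟩ := he.2.1 X 0 e' he'.1
  obtain ⟨b', hb'⟩ := he'.2.2 X 0 e he.1
  refine ⟨(C.Hom X X).inj _ b - (C.Hom X X).inj _ b', ?_⟩
  have e0 : ksgn (par (0 : G)) = 1 := by simp [par_zero, ksgn]
  rw [e0, one_smul, hb] at hb'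
  rw [map_sub, d_inj, d_inj, ← add_sub_assoc, hb', add_sub_cancel_right]

/-- `α` is a chain map inducing `α'` in cohomology. -/
structure Induces {X Y A B : C.Obj} (α : (C.Hom X Y).Tot →ₗ[K] (C.Hom A B).Tot)
    (α' : C.H X Y →ₗ[K] C.H A B) : Prop where
  d : ∀ x, α (C.d X Y x) = C.d A B (α x)
  cls : ∀ z : C.Z X Y, C.clsExt A B (α z) = α' (C.cls X Y z)

theorem Induces.id (X Y : C.Obj) :
    Induces (LinearMap.id : (C.Hom X Y).Tot →ₗ[K] _) (LinearMap.id : C.H X Y →ₗ[K] _) :=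
  ⟨fun _ => rfl, clsExt_cocycle⟩

/-- By the Leibniz rule `d_cmp`, composing with a cocycle on the left commutes with the differential
without any sign. -/
theorem Induces.cmp_left {X Y Z : C.Obj} {a : (C.Hom Y Z).V 0} (ha : C.μ₁ a = 0) :
    Induces (C.cmp X Y Z ((C.Hom Y Z).inj 0 a)) (C.hcmp X Y Z (C.cls Y Z (hom₀ a ha))) where
  d x := by rw [d_cmp, d_inj, ha]; simp
  cls z := by rw [hcmp_cls, ← clsExt_cocycle]; rfl

/-- On this side the Leibniz rule twists `a`; the twist is trivial because `a` has degree zero. -/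
theorem Induces.cmp_right {X Y Z : C.Obj} {a : (C.Hom X Y).V 0} (ha : C.μ₁ a = 0) :
    Induces ((C.cmp X Y Z).flip ((C.Hom X Y).inj 0 a))
      ((C.hcmp X Y Z).flip (C.cls X Y (hom₀ a ha))) where
  d x := by
    rw [LinearMap.flip_apply, LinearMap.flip_apply, d_cmp, d_inj, ha, GrMod.tw_inj, mul_comm,
      par_zero, zero_mul]
    simp [ksgn]
  cls z := by
    rw [LinearMap.flip_apply, LinearMap.flip_apply, hcmp_cls, ← clsExt_cocycle]; rfl

/-- The cocycle `t` is a tensor of cocycles minus a boundary. On tensors of cocycles `kunneth`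
computes classes. On the boundary, each term still contains a differential after `α ⊗ β` is applied,
so it contributes zero. -/
theorem Represents.kunneth_tmap {X Y X' Y' A B A' B' : C.Obj}
    {t : (tens (C.Hom X Y) (C.Hom X' Y')).Tot} {c : C.H X Y ⊗[K] C.H X' Y'} (h : Represents t c)
    {α : (C.Hom X Y).Tot →ₗ[K] (C.Hom A B).Tot} {α' : C.H X Y →ₗ[K] C.H A B} (hα : Induces α α')
    {β : (C.Hom X' Y').Tot →ₗ[K] (C.Hom A' B').Tot} {β' : C.H X' Y' →ₗ[K] C.H A' B'}
    (hβ : Induces β β') :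
    C.kunneth A B A' B' (tmap α β t) = TensorProduct.map α' β' c := by
  obtain ⟨z, rfl, y, hy⟩ := h
  have h0 : C.kunneth A B A' B' ∘ₗ tmap α β ∘ₗ C.tensDiff X Y X' Y' = 0 := by
    refine tens_ext fun i j a b => ?_
    rw [LinearMap.comp_apply, LinearMap.comp_apply, tensDiff, LinearMap.add_apply, tmap_tmk₀,
      tmap_tmk₀, map_add, map_add, tmap_tmk, tmap_tmk, kunneth_tmk, kunneth_tmk]
    simp [hα.d, hβ.d, clsExt_d]
  have h1 : C.kunneth A B A' B' ∘ₗ tmap α β ∘ₗ TensorProduct.lift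
      ((tmk (C.Hom X Y) (C.Hom X' Y')).compl₁₂ (C.Z X Y).subtype (C.Z X' Y').subtype) =
      TensorProduct.map α' β' ∘ₗ TensorProduct.map (C.cls X Y) (C.cls X' Y') := by
    refine TensorProduct.ext' fun a b => ?_
    simp only [LinearMap.comp_apply, TensorProduct.lift.tmul, LinearMap.compl₁₂_apply, tmap_tmk,
      Submodule.subtype_apply, kunneth_tmk, hα.cls, hβ.cls, TensorProduct.map_tmul]
  rw [eq_sub_of_add_eq hy.symm, map_sub, map_sub]
  exact (congrArg₂ (· - ·) (LinearMap.congr_fun h1 z) (LinearMap.congr_fun h0 y)).trans (sub_zero _)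

theorem Hdeg_zero {X Y : C.Obj} {x : C.H X Y} (hx : x ∈ C.Hdeg 0 X Y) :
    ∃ (a : (C.Hom X Y).V 0) (ha : C.μ₁ a = 0), x = C.cls X Y (hom₀ a ha) := by
  obtain ⟨⟨z, hz⟩, ⟨a, ha⟩, rfl⟩ := hx
  change (C.Hom X Y).inj 0 a = z at ha
  subst ha
  refine ⟨a, ?_, rfl⟩
  rw [← d_inj]
  exact hz

end AInfCat

/-! ### Naturality of copairing shadows -/

namespace PreBimod

variable {C : AInfCat.{u, v, w} K G}

/-- Identifies the boundaries produced by `IsClosedMor.diag_natural` for a Yoneda bimodule with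
those that `kunneth` kills. -/
theorem yon_act_nil_nil (A B X Y : C.Obj) :
    (yon C A B).act X X Y Y (nil X) (nil Y) = C.tensDiff X B A Y := by
  change tmap (diagAct C (nil X) (nil B)) LinearMap.id +
    tmap ((C.Hom X B).tw 1) (diagAct C (nil A) (nil Y)) = _
  rw [diagAct_nil_nil, diagAct_nil_nil]
  rfl

/-- The covariant action on a Yoneda bimodule twists the first factor by its Koszul sign and the
second through `diagAct_nil_single`. Together these form the total twist, a scalar on a homogeneous
tensor. -/
theorem tmap_tw_neg_comp_tw {A B B' : GrMod.{v, w} K G} (β : B.Tot →ₗ[K] B'.Tot) {k : G}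
    {t : (tens A B).Tot} (ht : t ∈ LinearMap.range ((tens A B).inj k)) :
    tmap (A.tw 1) (-(β ∘ₗ B.tw 1)) t = -(ksgn (par k) • tmap LinearMap.id β t) := by
  obtain ⟨t, rfl⟩ := ht
  have e : tmap (A.tw 1) (-(β ∘ₗ B.tw 1)) =
      -(tmap LinearMap.id β ∘ₗ tmap (A.tw 1) (B.tw 1)) := by
    rw [tmap_comp]
    exact map_neg (tmapLin A B A B' (A.tw 1)) _
  rw [e, tmap_tw_tw, LinearMap.neg_apply, LinearMap.comp_apply, GrMod.tw_inj, map_zsmul, one_mul]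

/-- The value of a pre-morphism `φ : C_Δ → Y_{B,B'}` at `e ∈ hom(A, A)`. -/
abbrev valAt {A B B' : C.Obj} (e : (C.Hom A A).V 0) (φ : Cochain (diag C) (yon C B B')) :
    (tens (C.Hom A B') (C.Hom B A)).Tot :=
  φ A A A A (nil A) (nil A) ((C.Hom A A).inj 0 e)

theorem valAt_mem {A B B' : C.Obj} (e : (C.Hom A A).V 0) {d : G}
    {φ : Cochain (diag C) (yon C B B')} (hφ : φ ∈ HomSub (diag C) (yon C B B') d) :
    valAt e φ ∈ LinearMap.range ((tens (C.Hom A B') (C.Hom B A)).inj d) := by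
  have h := hφ.2.2 A A A A (nil A) (nil A) 0 e
  have e' : 0 + (d + (nil A : Pth C.Hom A A).rdeg + (nil A : Pth C.Hom A A).rdeg) = d := by
    simp [rdeg]
  rw [e'] at h
  exact h

/-- The class of `φ(e_A)` does not depend on the choice of the cohomological unit. -/
theorem represents_valAt_unit {d : G} {B B' A : C.Obj} {φ : Cochain (diag C) (yon C B B')}
    (hφ : IsClosedMor d φ) {e e' : (C.Hom A A).V 0} (he : C.IsCohUnit A e)
    (he' : C.IsCohUnit A e') {c : C.H A B' ⊗[K] C.H B A}
    (hc : AInfCat.Represents (valAt e φ) c) : AInfCat.Represents (valAt e' φ) c := by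
  obtain ⟨b, hb⟩ := AInfCat.IsCohUnit_sub he he'
  -- The units differ by the boundary of `b`, which `φ` maps to a boundary.
  let Φ : (C.Hom A A).Tot →ₗ[K] (tens (C.Hom A B') (C.Hom B A)).Tot := φ A A A A (nil A) (nil A)
  have h : Φ (C.d A A b) = -(ksgn (par d) • C.tensDiff A B' B A (Φ b)) :=
    (hφ.diag_map_d A A b).trans (by rw [yon_act_nil_nil]; rfl)
  refine hc.of_eq_add (-(ksgn (par d) • Φ b)) ?_
  change Φ _ = Φ _ + _
  rw [hb, map_add, h, map_neg, map_zsmul]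

/-- Naturality in `A` of the class of `φ(e_A) ∈ hom(A, B') ⊗ hom(B, A)`. -/
theorem map_valAt_eq {d : G} {B B' A A' : C.Obj} {φ : Cochain (diag C) (yon C B B')}
    (hφ : IsClosedMor d φ) {e : (C.Hom A A).V 0} (he : C.IsCohUnit A e) {e' : (C.Hom A' A').V 0}
    (he' : C.IsCohUnit A' e') {c : C.H A B' ⊗[K] C.H B A} {c' : C.H A' B' ⊗[K] C.H B A'}
    (hc : AInfCat.Represents (valAt e φ) c) (hc' : AInfCat.Represents (valAt e' φ) c')
    {x : C.H A A'} (hx : x ∈ C.Hdeg 0 A A') :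
    TensorProduct.map LinearMap.id (C.hcmp B A A' x) c =
      TensorProduct.map ((C.hcmp A A' B').flip x) LinearMap.id c' := by
  obtain ⟨a, ha, rfl⟩ := AInfCat.Hdeg_zero hx
  obtain ⟨n, hn⟩ := hφ.diag_natural ha he he'
  rw [yon_act_nil_nil] at hn
  -- A nonempty string acts on a Yoneda bimodule through one factor only: here the second, and in
  -- `e2` the first.
  have e1 : (yon C B B').act A A A A' (nil A) (cons 0 a (nil A')) (valAt e φ) =
      -(ksgn (par d) • tmap LinearMap.id (C.cmp B A A' ((C.Hom A A').inj 0 a)) (valAt e φ)) := by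
    change (0 + tmap ((C.Hom A B').tw 1) (diagAct C (nil B) (cons 0 a (nil A')))) _ = _
    rw [zero_add, diagAct_nil_single]
    exact tmap_tw_neg_comp_tw _ (valAt_mem e hφ.1)
  have e2 : (yon C B B').act A A' A' A' (cons 0 a (nil A')) (nil A') (valAt e' φ) =
      tmap ((C.cmp A A' B').flip ((C.Hom A A').inj 0 a)) LinearMap.id (valAt e' φ) := by
    change (tmap (diagAct C (cons 0 a (nil A')) (nil B')) LinearMap.id + 0) _ = _
    rw [add_zero, diagAct_single_nil]
  have h : -(ksgn (par d) • tmap LinearMap.id (C.cmp B A A' ((C.Hom A A').inj 0 a)) (valAt e φ)) +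
      ksgn (par d) • tmap ((C.cmp A A' B').flip ((C.Hom A A').inj 0 a)) LinearMap.id (valAt e' φ) =
      C.tensDiff A B' B A' n := by
    rw [← e1, ← e2]; exact hn
  have h' := (congrArg (C.kunneth A B' B A') h).trans (AInfCat.kunneth_tensDiff _)
  rw [map_add, map_neg, map_zsmul, map_zsmul,
    hc.kunneth_tmap (.id _ _) (.cmp_left ha), hc'.kunneth_tmap (.cmp_right ha) (.id _ _)] at h'
  -- Both sides carry the same sign `(-1)^d`, which squares to one.
  have h2 := congrArg (fun t => ksgn (par d) • t) (neg_add_eq_zero.1 h')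
  simpa only [ksgn_smul_ksgn_smul] using h2

/-! ### Values of a morphism to the inverse dualizing bimodule at units -/

/-- The pre-morphism `F(e_B) : C_Δ → Y_{B,B}`, for `F : C_Δ → C^!` of degree `d`. -/
abbrev unitImage (d : G) (F : Cochain (diag C) (dual C)) {B : C.Obj} (e : (C.Hom B B).V 0) :
    HomSub (diag C) (yon C B B) d :=
  (F B B B B (nil B) (nil B) ((C.Hom B B).inj 0 e) : ((dual C).M B B).Tot) d

/-- The unit has degree zero and `F` has degree `d`, so the value is concentrated in degree `d` and
taking that component loses nothing. -/
theorem inj_unitImage {d : G} {F : Cochain (diag C) (dual C)} (hF : IsClosedMor d F) {B : C.Obj}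
    (e : (C.Hom B B).V 0) :
    F B B B B (nil B) (nil B) ((C.Hom B B).inj 0 e) =
      ((dual C).M B B).inj d (unitImage d F e) := by
  have h := hF.1.2.2 B B B B (nil B) (nil B) 0 e
  have e' : 0 + (d + (nil B : Pth C.Hom B B).rdeg + (nil B : Pth C.Hom B B).rdeg) = d := by
    simp [rdeg]
  rw [e'] at h
  exact (GrMod.inj_apply_of_mem h).symm

theorem dual_act_inj {d : G} {A A' B B' : C.Obj} (r : Pth C.Hom A' A) (l : Pth C.Hom B B')
    (φ : HomSub (diag C) (yon C A B) d) :
    (dual C).act A' A B B' r l (((dual C).M A B).inj d φ) =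
      ((dual C).M A' B').inj (d + r.rdeg + l.rdeg + deg1 G)
        ⟨dualAct d r l φ.1, dualAct_mem r l φ.2⟩ := by
  exact GrMod.toModule_inj (A := (dual C).M A B) (fun d =>
    ((dual C).M A' B').inj (d + r.rdeg + l.rdeg + deg1 G) ∘ₗ
      (dualAct d r l).restrict fun _ hφ => dualAct_mem r l hφ) d φ

/-- The differential of `C^!` is `δ`, and `F`, a chain map up to sign, sends the cocycle `e` to a
cocycle. This makes naturality available a second time, for `F(e_B)` itself. -/
theorem unitImage_closed {d : G} {F : Cochain (diag C) (dual C)} (hF : IsClosedMor d F)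
    {B : C.Obj} {e : (C.Hom B B).V 0} (he : C.IsCohUnit B e) :
    IsClosedMor d (unitImage d F e).1 := by
  refine ⟨(unitImage d F e).2, ?_⟩
  have h := hF.nil_nil B B ((C.Hom B B).inj 0 e)
  rw [diag_act_unit he, map_zero, smul_zero, inj_unitImage hF, dual_act_inj] at h
  exact congrArg Subtype.val
    (GrMod.inj_injective _ _ (h.trans (map_zero (((dual C).M B B).inj _)).symm))

/-- Evaluation of elements of `C^!(B, B')` at `e ∈ hom(A, A)`. -/
def evalUnit {A : C.Obj} (e : (C.Hom A A).V 0) (B B' : C.Obj) :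
    ((dual C).M B B').Tot →ₗ[K] (tens (C.Hom A B') (C.Hom B A)).Tot :=
  DirectSum.toModule K G _ fun d => evalAt B B' d (nil A) (nil A) ((C.Hom A A).inj 0 e)

theorem evalUnit_inj {A : C.Obj} (e : (C.Hom A A).V 0) {B B' : C.Obj} {d : G}
    (φ : HomSub (diag C) (yon C B B') d) :
    evalUnit e B B' (((dual C).M B B').inj d φ) = valAt e φ.1 := by
  exact GrMod.toModule_inj (A := (dual C).M B B')
    (fun d => evalAt B B' d (nil A) (nil A) ((C.Hom A A).inj 0 e)) d φ

/-- Evaluation at a unit is a chain map: of the terms of `δ φ` on empty strings, the one applying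
`φ` to the differential of `e` vanishes, leaving the differential of `φ(e)`. -/
theorem evalUnit_act_nil_nil {A : C.Obj} {e : (C.Hom A A).V 0} (he : C.IsCohUnit A e)
    {B B' : C.Obj} (ψ : ((dual C).M B B').Tot) :
    evalUnit e B B' ((dual C).act B B B' B' (nil B) (nil B') ψ) =
      C.tensDiff A B' B A (evalUnit e B B' ψ) := by
  suffices h : evalUnit e B B' ∘ₗ (dual C).act B B B' B' (nil B) (nil B') =
      C.tensDiff A B' B A ∘ₗ evalUnit e B B' from LinearMap.congr_fun h ψ
  refine GrMod.tot_ext fun k (φ : HomSub (diag C) (yon C B B') k) => ?_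
  refine (congrArg (evalUnit e B B') (dual_act_inj (nil B) (nil B') φ)).trans ?_
  refine (evalUnit_inj e _).trans (Eq.trans ?_ (congrArg (C.tensDiff A B' B A)
    (evalUnit_inj e φ)).symm)
  change δ k φ.1 A A A A (nil A) (nil A) ((C.Hom A A).inj 0 e) = _
  change comp (par k) (yon C B B').act φ.1 A A A A (nil A) (nil A) ((C.Hom A A).inj 0 e) -
    ksgn (par k) • preB φ.1 A A A A (nil A) (nil A) ((C.Hom A A).inj 0 e) = _
  have h1 : preB φ.1 A A A A (nil A) (nil A) ((C.Hom A A).inj 0 e) = 0 := by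
    rw [preB, barSum_nil (φ.2.1 A A A A (nil A)), barSum_nil (φ.2.2.1 A A A A (nil A)),
      LinearMap.zero_comp, smul_zero, add_zero, zero_add]
    exact (comp_nil_nil 1 φ.1 (diag C).act A A _).trans
      ((congrArg (φ.1 A A A A (nil A) (nil A)) (diag_act_unit he)).trans (map_zero _))
  have h2 := comp_nil_nil (par k) (yon C B B').act φ.1 A A ((C.Hom A A).inj 0 e)
  rw [h1, smul_zero, sub_zero]
  refine h2.trans ?_
  rw [yon_act_nil_nil]
  rfl

/-- The string `y` is odd, so moving it past a pre-morphism of degree `d` gives `(-1)^d`. The twist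
in `mapL` cancels the one in `diagAct_nil_single`, and the remaining minus sign is that of the
diagonal action. -/
theorem evalUnit_act_nil_single {A : C.Obj} (e : (C.Hom A A).V 0) {B B' : C.Obj}
    (y : (C.Hom B B').V 0) {d : G} (φ : HomSub (diag C) (yon C B B) d) :
    evalUnit e B B' ((dual C).act B B B B' (nil B) (cons 0 y (nil B'))
      (((dual C).M B B).inj d φ)) =
      -(ksgn (par d) • tmap (C.cmp A B B' ((C.Hom B B').inj 0 y)) LinearMap.id (valAt e φ.1)) := by
  rw [dual_act_inj, evalUnit_inj]
  change (ksgn (par (cons 0 y (nil B')).rdeg * (par (0 : G) + par d) + par d * par (0 : G)) •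
    tmap (diagAct C (nil A) (cons 0 y (nil B')) ∘ₗ
      (C.Hom A B).tw (par (cons 0 y (nil B')).rdeg)) LinearMap.id) (valAt e φ.1) = _
  rw [par_rdeg_single, diagAct_nil_single, par_zero, zero_add, mul_zero, add_zero, one_mul,
    LinearMap.neg_comp, LinearMap.comp_assoc, GrMod.tw_tw, LinearMap.comp_id,
    LinearMap.smul_apply, ← smul_neg]
  congr 1
  exact LinearMap.congr_fun
    (map_neg ((tmapLin _ _ _ _).flip (LinearMap.id : (C.Hom B A).Tot →ₗ[K] _)) _) _

/-- The twist in `mapR` has parity `‖y‖ + 1`, which is even, so no sign survives. -/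
theorem evalUnit_act_single_nil {A : C.Obj} (e : (C.Hom A A).V 0) {B B' : C.Obj}
    (y : (C.Hom B B').V 0) {d : G} (φ : HomSub (diag C) (yon C B' B') d) :
    evalUnit e B B' ((dual C).act B B' B' B' (cons 0 y (nil B')) (nil B')
      (((dual C).M B' B').inj d φ)) =
      tmap LinearMap.id ((C.cmp B B' A).flip ((C.Hom B B').inj 0 y)) (valAt e φ.1) := by
  rw [dual_act_inj, evalUnit_inj]
  change tmap ((C.Hom A B').tw (par (cons 0 y (nil B')).rdeg + 1))
    (diagAct C (cons 0 y (nil B')) (nil A)) (valAt e φ.1) = _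
  rw [par_rdeg_single, diagAct_single_nil, show (1 + 1 : ZMod 2) = 0 from rfl, GrMod.tw_zero]

/-- The class of `(F(e_B))(e_A)` does not depend on the choice of the unit `e_B`. -/
theorem represents_unitImage_unit {d : G} {F : Cochain (diag C) (dual C)} (hF : IsClosedMor d F)
    {A B : C.Obj} {e₁ : (C.Hom A A).V 0} (he₁ : C.IsCohUnit A e₁) {e e' : (C.Hom B B).V 0}
    (he : C.IsCohUnit B e) (he' : C.IsCohUnit B e') {c : C.H A B ⊗[K] C.H B A}
    (hc : AInfCat.Represents (valAt e₁ (unitImage d F e).1) c) :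
    AInfCat.Represents (valAt e₁ (unitImage d F e').1) c := by
  obtain ⟨b, hb⟩ := AInfCat.IsCohUnit_sub he he'
  let Φ : (C.Hom B B).Tot →ₗ[K] (tens (C.Hom A B) (C.Hom B A)).Tot :=
    evalUnit e₁ B B ∘ₗ F B B B B (nil B) (nil B)
  have hΦ : ∀ e, Φ ((C.Hom B B).inj 0 e) = valAt e₁ (unitImage d F e).1 := fun e =>
    (congrArg (evalUnit e₁ B B) (inj_unitImage hF e)).trans (evalUnit_inj e₁ _)
  have h : Φ (C.d B B b) = -(ksgn (par d) • C.tensDiff A B B A (Φ b)) := by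
    refine (congrArg (evalUnit e₁ B B) (hF.diag_map_d B B b)).trans ?_
    rw [map_neg, map_zsmul, evalUnit_act_nil_nil he₁]
    rfl
  refine hc.of_eq_add (-(ksgn (par d) • Φ b)) ?_
  rw [← hΦ, ← hΦ, hb, map_add, h, map_neg, map_zsmul]

/-- Naturality in `B` of the class of `(F(e_B))(e_A) ∈ hom(A, B) ⊗ hom(B, A)`. -/
theorem map_unitImage_eq {d : G} {F : Cochain (diag C) (dual C)} (hF : IsClosedMor d F)
    {A B B' : C.Obj} {e₁ : (C.Hom A A).V 0} (he₁ : C.IsCohUnit A e₁)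
    {e : (C.Hom B B).V 0} (he : C.IsCohUnit B e) {e' : (C.Hom B' B').V 0}
    (he' : C.IsCohUnit B' e') {c : C.H A B ⊗[K] C.H B A} {c' : C.H A B' ⊗[K] C.H B' A}
    (hc : AInfCat.Represents (valAt e₁ (unitImage d F e).1) c)
    (hc' : AInfCat.Represents (valAt e₁ (unitImage d F e').1) c')
    {y : C.H B B'} (hy : y ∈ C.Hdeg 0 B B') :
    TensorProduct.map (C.hcmp A B B' y) LinearMap.id c =
      TensorProduct.map LinearMap.id ((C.hcmp B B' A).flip y) c' := by
  obtain ⟨a, ha, rfl⟩ := AInfCat.Hdeg_zero hy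
  obtain ⟨n, hn⟩ := hF.diag_natural ha he he'
  rw [inj_unitImage hF, inj_unitImage hF] at hn
  -- The identity in `C^!(B, B')` is evaluated at the unit of `A`; evaluation is a chain map, so the
  -- boundary stays one.
  have h := congrArg (evalUnit e₁ B B') hn
  rw [map_add, map_zsmul, evalUnit_act_nil_single, evalUnit_act_single_nil,
    evalUnit_act_nil_nil he₁] at h
  have h' := (congrArg (C.kunneth A B' B A) h).trans (AInfCat.kunneth_tensDiff _)
  rw [map_add, map_neg, map_zsmul, map_zsmul, hc.kunneth_tmap (.cmp_left ha) (.id _ _),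
    hc'.kunneth_tmap (.id _ _) (.cmp_right ha)] at h'
  have h2 := congrArg (fun t => ksgn (par d) • t) (neg_add_eq_zero.1 h')
  simpa only [ksgn_smul_ksgn_smul] using h2

/-! ### Algebraic openness of summands -/

/-- In a contraction the map on the first leg is absorbed into the functional and the map on the
second leg comes outside. This turns the tensor identities of naturality into identities between
morphisms. -/
theorem contract_map {A A' B B' : Type w} [AddCommGroup A] [Module K A] [AddCommGroup A']
    [Module K A'] [AddCommGroup B] [Module K B] [AddCommGroup B'] [Module K B']
    (φ : Module.Dual K A') (α : A →ₗ[K] A') (β : B →ₗ[K] B') (c : A ⊗[K] B) :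
    TensorProduct.lid K B' (LinearMap.rTensor B' φ (TensorProduct.map α β c)) =
      β (TensorProduct.lid K B (LinearMap.rTensor B (φ ∘ₗ α) c)) := by
  induction c with
  | zero => simp
  | add x y hx hy => simp only [map_add, hx, hy]
  | tmul a b => simp

/-- Copairing shadows of a closed morphism `C_Δ → C^!` transfer entire degeneracy to idempotent
summands. -/
theorem EntirelyDegenerate.summand {d : G} {F : Cochain (diag C) (dual C)}
    (hF : IsClosedMor d F) {c : ∀ A B : C.Obj, C.H A B ⊗[K] C.H B A}
    (hc : ∀ A B, IsCopairingShadow C d F A B (c A B)) {L M : C.Obj}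
    (hL : EntirelyDegenerate (c L L)) (hM : C.IsSummand M L) : EntirelyDegenerate (c M M) := by
  -- Each shadow may come with its own units; all are moved to one fixed choice so that shadows at
  -- different pairs can be compared.
  have hrep : ∀ A B, AInfCat.Represents (valAt (C.unitRep A) (unitImage d F (C.unitRep B)).1)
      (c A B) := by
    intro A B
    obtain ⟨eA, eB, hA, hB, z, hz, y, hy⟩ := hc A B
    rw [tensD, yon_act_nil_nil] at hy
    exact represents_unitImage_unit hF (AInfCat.unitRep_spec A) hB (AInfCat.unitRep_spec B)
      (represents_valAt_unit (unitImage_closed hF hB) hA (AInfCat.unitRep_spec A) ⟨z, hz, y, hy⟩)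
  obtain ⟨i, hi, p, hp, hpi⟩ := hM
  -- Naturality along `i` in each variable in turn, with `c L M` as the intermediate term between `c
  -- M M` and `c L L`.
  have h₁ := map_valAt_eq (unitImage_closed hF (AInfCat.unitRep_spec M)) (AInfCat.unitRep_spec M)
    (AInfCat.unitRep_spec L) (hrep M M) (hrep L M) hi
  have h₂ := map_unitImage_eq hF (AInfCat.unitRep_spec L) (AInfCat.unitRep_spec M)
    (AInfCat.unitRep_spec L) (hrep L M) (hrep L L) hi
  intro φ
  -- The functional is `y ↦ φ(p ∘ y ∘ i)`, chosen so that `p ∘ i = id` gives `ψ(i ∘ a) = φ(a ∘ i)`.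
  let ψ : Module.Dual K (C.H L L) := (φ ∘ₗ (C.hcmp M L M).flip i) ∘ₗ C.hcmp L L M p
  set w : C.H M M := TensorProduct.lid K (C.H M M) (LinearMap.rTensor (C.H M M) φ (c M M)) with hw
  set u : C.H L L := TensorProduct.lid K (C.H L L) (LinearMap.rTensor (C.H L L) ψ (c L L)) with hu
  have hψ : ψ ∘ₗ C.hcmp L M L i = φ ∘ₗ (C.hcmp M L M).flip i := by
    refine LinearMap.ext fun a => ?_
    change φ (C.hcmp M L M (C.hcmp L L M p (C.hcmp L M L i a)) i) = φ (C.hcmp M L M a i)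
    rw [AInfCat.hcmp_assoc, hpi, AInfCat.hid_hcmp]
  -- Both sides equal the contraction of `c L M` with `a ↦ φ(a ∘ i)`.
  have key : C.hcmp M M L i w = C.hcmp M L L u i := by
    have e₁ := contract_map φ LinearMap.id (C.hcmp M M L i) (c M M)
    rw [h₁, contract_map, LinearMap.comp_id, LinearMap.id_apply] at e₁
    have e₂ := contract_map ψ LinearMap.id ((C.hcmp M L L).flip i) (c L L)
    rw [← h₂, contract_map, LinearMap.comp_id, LinearMap.id_apply, hψ] at e₂
    exact e₁.symm.trans e₂
  have hpow : ∀ n : ℕ, C.hcmp M M L i (w ^ n) = C.hcmp M L L (u ^ n) i := by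
    intro n
    induction n with
    | zero => rw [pow_zero, pow_zero]; exact (AInfCat.hcmp_hid i).trans (AInfCat.hid_hcmp i).symm
    | succ n ih =>
      rw [pow_succ, pow_succ]
      change C.hcmp M M L i (C.hcmp M M M (w ^ n) w) = C.hcmp M L L (C.hcmp L L L (u ^ n) u) i
      rw [AInfCat.hcmp_assoc, ih, ← AInfCat.hcmp_assoc, key, AInfCat.hcmp_assoc]
  obtain ⟨n, hn⟩ := hL ψ
  have hn' : u ^ n = 0 := hn
  refine ⟨n, ?_⟩
  change w ^ n = 0
  -- `w^n = p ∘ i ∘ w^n = p ∘ u^n ∘ i`, so the exponent that kills `u` also kills `w`.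
  rw [← AInfCat.hid_hcmp (w ^ n), ← hpi, ← AInfCat.hcmp_assoc, hpow, hn']
  simp

end PreBimod

end OpenString

end

/-! ### The two clauses of the lemma -/

theorem mainTheorem7 {K : Type v} [Field K] {G : Type} [OpenString.GradingDatum G]
    [DecidableEq G] (P : OpenString.AInfCat.{u, v, w} K G) (S : Set P.Obj)
    (hP : P.IsPerfClosure S) (n : ℤ) :
    (∀ f : OpenString.PreBimod.Cochain (OpenString.PreBimod.diag (P.full S))
          (OpenString.PreBimod.dual (P.full S)),
      OpenString.PreBimod.IsClosedMor (n • OpenString.deg1 G) f →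
      ∀ c : ∀ A B : P.Obj, TensorProduct K (P.H A B) (P.H B A),
        OpenString.PreBimod.IsShadowFamily S (n • OpenString.deg1 G) f c →
        ∀ L M : P.Obj, OpenString.EntirelyDegenerate (c L L) → P.IsSummand M L →
          OpenString.EntirelyDegenerate (c M M)) ∧
    (∀ σ : OpenString.PreBimod.HString (P.full S) →₀ K,
      OpenString.PreBimod.IsWeakSmoothCY (n • OpenString.deg1 G) σ →
      ∀ f : OpenString.PreBimod.Cochain (OpenString.PreBimod.diag (P.full S))
          (OpenString.PreBimod.dual (P.full S)),
        OpenString.PreBimod.IsInverseOfEv (n • OpenString.deg1 G) σ f →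
        ∀ c : ∀ A B : P.Obj, TensorProduct K (P.H A B) (P.H B A),
          OpenString.PreBimod.IsShadowFamily S (n • OpenString.deg1 G) f c →
          ∀ L M : P.Obj, OpenString.EntirelyDegenerate (c L L) → P.IsSummand M L →
            OpenString.EntirelyDegenerate (c M M)) := by
  have key : ∀ f : OpenString.PreBimod.Cochain (OpenString.PreBimod.diag (P.full S))
        (OpenString.PreBimod.dual (P.full S)),
      ∀ c : ∀ A B : P.Obj, TensorProduct K (P.H A B) (P.H B A),
        OpenString.PreBimod.IsShadowFamily S (n • OpenString.deg1 G) f c →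
        ∀ L M : P.Obj, OpenString.EntirelyDegenerate (c L L) → P.IsSummand M L →
          OpenString.EntirelyDegenerate (c M M) := by
    -- The shadows are by definition those of a closed morphism `F` on `P` itself, so the summand
    -- argument is run in `P`.
    rintro f c ⟨F, hF, -, hc⟩ L M hL hM
    exact OpenString.PreBimod.EntirelyDegenerate.summand hF hc hL hM
  exact ⟨fun f _ => key f, fun _ _ f _ => key f⟩
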